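/- Let $p$ be a prime, let $k$ be an algebraically closed field of characteristic $p$, and let $G$ be a finite group that is $p$-nilpotent (i.e. $G$ has a normal subgroup of order prime to $p$ whose index is a power of $p$) and whose Sylow $p$-subgroups are cyclic. Let $M$ be a finitely generated left $kG$-module. Then the endomorphism algebra $E_G(M)=\operatorname{End}_{kG}(M)$ is a symmetric $k$-algebra if and only if, for every block idempotent $e_B$ of $kG$, the $kG$-submodule $e_B M=\{e_B m : m\in M\}$ is isotypic. Here a $k$-algebra $\Lambda$ is symmetric if $\Lambda\cong\operatorname{Hom}_k(\Lambda,k)$ as $(\Lambda,\Lambda)$-bimodules; a block idempotent of $kG$ is a primitive idempotent of the center $Z(kG)$, i.e. a nonzero central idempotent that is not the sum of two nonzero orthogonal central idempotents; a module is indecomposable if it is nonzero and is not the direct sum of two nonzero submodules; and a module is isotypic if all of its indecomposable direct summands are isomorphic to one another (in particular the zero module is isotypic). -/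

import Mathlib

open scoped MonoidAlgebra

/-- A `k`-algebra `A` is symmetric if `A` is isomorphic to its `k`-dual `Hom_k(A, k)` as an
`(A, A)`-bimodule, where the bimodule structure of the dual is `(a φ b)(y) = φ (b y a)`. -/
def IsSymmetricAlg (k A : Type*) [Field k] [Ring A] [Algebra k A] : Prop :=
  ∃ f : A ≃ₗ[k] Module.Dual k A, ∀ a b x y : A, f (a * x * b) y = f x (b * y * a)

/-- A module is indecomposable if it is nonzero and is not the internal direct sum of two
nonzero submodules. -/
def IsIndecomposableModule (R M : Type*) [Ring R] [AddCommGroup M] [Module R M] : Prop :=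
  Nontrivial M ∧ ∀ N N' : Submodule R M, IsCompl N N' → N = ⊥ ∨ N' = ⊥

/-- A module is isotypic if any two of its indecomposable direct summands are isomorphic.
(The summands need not be simple, so this differs from `IsIsotypic`.) -/
def IsIsotypicModule (R M : Type*) [Ring R] [AddCommGroup M] [Module R M] : Prop :=
  ∀ N N' : Submodule R M,
    (∃ C : Submodule R M, IsCompl N C) → (∃ C' : Submodule R M, IsCompl N' C') →
    IsIndecomposableModule R N → IsIndecomposableModule R N' → Nonempty (N ≃ₗ[R] N')

/-- The block idempotents of a ring: the nonzero central idempotents that are not a sum of two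
nonzero orthogonal central idempotents. -/
structure IsBlockIdempotent {R : Type*} [Ring R] (e : R) : Prop where
  mem_center : e ∈ Subring.center R
  isIdempotentElem : IsIdempotentElem e
  ne_zero : e ≠ 0
  primitive : ∀ f g : R, f ∈ Subring.center R → g ∈ Subring.center R →
    IsIdempotentElem f → IsIdempotentElem g → f * g = 0 → f + g = e → f = 0 ∨ g = 0

/-- For a central element `e`, the submodule `e M = {e m | m ∈ M}` of `M`. -/
def centralSMul {R : Type*} [Ring R] (e : R) (he : e ∈ Subring.center R)
    (M : Type*) [AddCommGroup M] [Module R M] : Submodule R M where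
  carrier := Set.range (fun m : M => e • m)
  add_mem' := by
    rintro _ _ ⟨x, rfl⟩ ⟨y, rfl⟩
    exact ⟨x + y, smul_add e x y⟩
  zero_mem' := ⟨0, smul_zero e⟩
  smul_mem' := by
    rintro r _ ⟨x, rfl⟩
    refine ⟨r • x, ?_⟩
    simp only [smul_smul, Subring.mem_center_iff.mp he r]

/-- A finite group is `p`-nilpotent if it has a normal `p`-complement: a normal subgroup whose
order is prime to `p` and whose index is a power of `p`. -/
def IsPNilpotent (p : ℕ) (G : Type*) [Group G] : Prop :=
  ∃ N : Subgroup G, N.Normal ∧ (Nat.card N).Coprime p ∧ ∃ n : ℕ, N.index = p ^ n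

/-! A finite-dimensional algebra is symmetric exactly when it carries a nondegenerate trace form.
Such forms pass to corners and finite products, and central idempotents of `kG` split `End M` as a
product, so it suffices to treat one `W = eM` with `e` a block idempotent.

Let `N` be the normal `p`-complement and `S` the image of `kN`, semisimple by Maschke. As `k` is
algebraically closed, `1` is a sum of idempotents `i` of `S` with `iSi = ki`. The corner `i kG i` is
spanned by pieces indexed by `G/N`, each of dimension at most one, whose nonzero elements are units
of the corner. The quotient `G/N` is a cyclic `p`-group, so one unit `u` generates the corner, and
`u ^ (p ^ m)` is a scalar multiple of `i`. Rescaling `u` by a root and subtracting `i` gives a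
nilpotent generator `x` (`IsRankOneIdempotent.exists_nilpotent_generator`). For suitable `i` the
block idempotent lies in `AiA`, where `A = kG`, so restriction to `iW` is an isomorphism from `End
W` onto the endomorphisms of a nilpotent `k[X]`-module (`bijective_cornerRestrictHom`).

Being isotypic depends only on the endomorphism ring (`isIsotypicModule_iff`), so the question is
about sums of modules `k[X]/(X^a)`. If all nonzero summands have one length, the endomorphisms form
a matrix algebra over `k[X]/(X^a)`, which is symmetric. If two lengths differ, every trace form
degenerates at the socle of the longer summand (`IsSymmetrizingForm.le_of_retract`). -/

/-! ### Symmetric algebras and trace forms -/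

section SymmetricAlgebras

/-- A linear form exhibiting `A` as a symmetric algebra: a trace form whose associated bilinear
form is nondegenerate. -/
structure IsSymmetrizingForm (k : Type*) {A : Type*} [Field k] [Ring A] [Algebra k A]
    (l : A →ₗ[k] k) : Prop where
  mul_comm : ∀ a b, l (a * b) = l (b * a)
  nondegenerate : ∀ a, (∀ b, l (a * b) = 0) → a = 0

/-- A bimodule isomorphism is determined by its value at `1`, which is the form. Conversely a form
gives an injection of `A` into its dual, bijective by dimension. -/
theorem isSymmetricAlg_iff {k A : Type*} [Field k] [Ring A] [Algebra k A]
    [FiniteDimensional k A] :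
    IsSymmetricAlg k A ↔ ∃ l : A →ₗ[k] k, IsSymmetrizingForm k l := by
  constructor
  · rintro ⟨f, hf⟩
    have h1 : ∀ x y, f x y = f 1 (y * x) := fun x y => by simpa using hf x 1 1 y
    have h2 : ∀ x y, f x y = f 1 (x * y) := fun x y => by simpa using hf 1 x 1 y
    refine ⟨f 1, fun a b => by rw [← h2, h1], fun a ha => ?_⟩
    apply f.injective
    ext b
    rw [h2, ha]
    simp
  · rintro ⟨l, hc, hn⟩
    let g : A →ₗ[k] Module.Dual k A := (LinearMap.mul k A).compr₂ l
    have hg : ∀ a b, g a b = l (a * b) := fun a b => rfl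
    have hinj : Function.Injective g := by
      rw [← LinearMap.ker_eq_bot, LinearMap.ker_eq_bot']
      intro a ha
      refine hn a fun b => ?_
      rw [← hg, ha]
      rfl
    refine ⟨LinearEquiv.ofInjectiveOfFinrankEq g hinj Subspace.dual_finrank_eq.symm, ?_⟩
    intro a b x y
    change l (a * x * b * y) = l (x * (b * y * a))
    rw [mul_assoc, mul_assoc, hc, mul_assoc]

theorem IsSymmetricAlg.of_algEquiv {k A B : Type*} [Field k] [Ring A] [Algebra k A]
    [Ring B] [Algebra k B] (e : A ≃ₐ[k] B) (h : IsSymmetricAlg k A) : IsSymmetricAlg k B := by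
  obtain ⟨f, hf⟩ := h
  refine ⟨e.symm.toLinearEquiv.trans (f.trans e.symm.toLinearEquiv.dualMap), ?_⟩
  intro a b x y
  have key : ∀ z w, (e.symm.toLinearEquiv.trans (f.trans e.symm.toLinearEquiv.dualMap)) z w
      = f (e.symm z) (e.symm w) := fun z w => rfl
  rw [key, key]
  simp [hf]

theorem AlgEquiv.isSymmetricAlg_iff {k A B : Type*} [Field k] [Ring A] [Algebra k A]
    [Ring B] [Algebra k B] (e : A ≃ₐ[k] B) : IsSymmetricAlg k A ↔ IsSymmetricAlg k B :=
  ⟨.of_algEquiv e, .of_algEquiv e.symm⟩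

theorem isSymmetricAlg_of_subsingleton (k A : Type*) [Field k] [Ring A] [Algebra k A]
    [Subsingleton A] : IsSymmetricAlg k A :=
  ⟨0, fun _ _ _ _ => rfl⟩

theorem IsSymmetrizingForm.matrix {k A n : Type*} [Field k] [Ring A] [Algebra k A]
    [Fintype n] [DecidableEq n] {l : A →ₗ[k] k} (h : IsSymmetrizingForm k l) :
    IsSymmetrizingForm k (l ∘ₗ Matrix.traceLinearMap n k A) := by
  constructor
  · intro M N
    simp only [LinearMap.comp_apply, Matrix.traceLinearMap_apply, Matrix.trace, Matrix.diag_apply,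
      Matrix.mul_apply, map_sum]
    rw [Finset.sum_comm]
    exact Finset.sum_congr rfl fun i _ => Finset.sum_congr rfl fun j _ => h.mul_comm _ _
  · intro M hM
    ext i j
    refine h.nondegenerate _ fun b => ?_
    -- Pairing with this matrix unit isolates `l (M i j * b)`.
    have := hM (Matrix.single j i b)
    simpa [Matrix.traceLinearMap_apply, Matrix.trace_mul_single] using this

variable {k R : Type*} [Field k] [Ring R] [Algebra k R]

theorem finiteDimensional_moduleEnd (M : Type*) [AddCommGroup M] [Module k M] [Module R M]
    [IsScalarTower k R M] [FiniteDimensional k M] : FiniteDimensional k (Module.End R M) :=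
  Module.Finite.of_injective (LinearMap.restrictScalarsₗ k R M M k)
    (LinearMap.restrictScalars_injective k)

variable {M N N' : Type*} [AddCommGroup M] [Module k M] [Module R M] [IsScalarTower k R M]
  [AddCommGroup N] [Module k N] [Module R N] [IsScalarTower k R N]
  [AddCommGroup N'] [Module k N'] [Module R N'] [IsScalarTower k R N']

/-- For `i : N → M` and `q : M → N`, the linear map `φ ↦ i φ q`. -/
def endConj (k : Type*) {R M N : Type*} [Field k] [Ring R] [Algebra k R]
    [AddCommGroup M] [Module k M] [Module R M] [IsScalarTower k R M]
    [AddCommGroup N] [Module k N] [Module R N] [IsScalarTower k R N]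
    (i : N →ₗ[R] M) (q : M →ₗ[R] N) : Module.End R N →ₗ[k] Module.End R M where
  toFun f := i ∘ₗ f ∘ₗ q
  map_add' f g := by ext; simp
  map_smul' c f := by
    ext x
    simp

@[simp] theorem endConj_apply (i : N →ₗ[R] M) (q : M →ₗ[R] N) (f : Module.End R N) (x : M) :
    endConj k i q f x = i (f (q x)) := rfl

/-- With `P = iq`, `End N` is the corner `P (End M) P`, and a trace form pairs this corner trivially
with everything outside it. -/
theorem IsSymmetrizingForm.retract {l : Module.End R M →ₗ[k] k} (h : IsSymmetrizingForm k l)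
    (i : N →ₗ[R] M) (q : M →ₗ[R] N) (hq : ∀ x, q (i x) = x) :
    IsSymmetrizingForm k (l ∘ₗ endConj k i q) := by
  have hmul : ∀ f g : Module.End R N,
      endConj k i q (f * g) = endConj k i q f * endConj k i q g := by
    intro f g; ext x; simp [hq]
  constructor
  · intro f g
    simp only [LinearMap.comp_apply, hmul, h.mul_comm]
  · intro f hf
    have h0 : endConj k i q f = 0 := by
      refine h.nondegenerate _ fun g => ?_
      -- Write `1 = P + (1 - P)` on the right; the trace property moves `1 - P` to the left, where
      -- it kills `i f q`.
      have e1 : endConj k i q f * g = (endConj k i q f * g) * (i ∘ₗ q) + 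
        endConj k i q f * (g * (1 - (i ∘ₗ q : Module.End R M))) := by
        rw [mul_sub, mul_sub, mul_one, ← mul_assoc]; abel
      have e2 : (1 - (i ∘ₗ q : Module.End R M)) * endConj k i q f = 0 := by
        ext x; simp [hq]
      have e3 : (endConj k i q f * g) * (i ∘ₗ q) = endConj k i q (f * endConj k q i g) := by
        ext x; simp
      rw [e1, map_add, e3, h.mul_comm, mul_assoc, e2, mul_zero, map_zero, add_zero]
      exact hf _
    ext x
    have := congrArg q (LinearMap.congr_fun h0 (i x))
    simpa [hq] using this

/-- The hypothesis `hcomm` makes `iq` a central idempotent of `End M`, so `End M` is the product of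
`End N` and `End N'`, and the forms add. -/
theorem IsSymmetrizingForm.prod {l : Module.End R N →ₗ[k] k} {l' : Module.End R N' →ₗ[k] k}
    (h : IsSymmetrizingForm k l) (h' : IsSymmetrizingForm k l')
    (i : N →ₗ[R] M) (q : M →ₗ[R] N) (hq : ∀ x, q (i x) = x)
    (i' : N' →ₗ[R] M) (q' : M →ₗ[R] N') (hq' : ∀ x, q' (i' x) = x)
    (hsum : ∀ x, i (q x) + i' (q' x) = x)
    (hcomm : ∀ (f : Module.End R M) (x : M), i (q (f x)) = f (i (q x))) :
    IsSymmetrizingForm k (l ∘ₗ endConj k q i + l' ∘ₗ endConj k q' i') := by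
  have hcomm' : ∀ (f : Module.End R M) (x : M), i' (q' (f x)) = f (i' (q' x)) := by
    intro f x
    have h1 := hsum (f x)
    have h2 := congrArg f (hsum x)
    rw [map_add, ← hcomm] at h2
    exact add_left_cancel (h1.trans h2.symm)
  have hm : ∀ f g, endConj k q i (f * g) = endConj k q i f * endConj k q i g := by
    intro f g; ext x; simp [hcomm, hq]
  have hm' : ∀ f g, endConj k q' i' (f * g) = endConj k q' i' f * endConj k q' i' g := by
    intro f g; ext x; simp [hcomm', hq']
  have hqi' : ∀ x, q (i' x) = 0 := by
    intro x
    have h1 := hsum (i' x)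
    rw [hq', add_eq_right] at h1
    rw [← hq (q (i' x)), h1, map_zero]
  have hqi : ∀ x, q' (i x) = 0 := by
    intro x
    have h1 := hsum (i x)
    rw [hq, add_eq_left] at h1
    rw [← hq' (q' (i x)), h1, map_zero]
  constructor
  · intro f g
    simp only [LinearMap.add_apply, LinearMap.comp_apply, hm, hm', h.mul_comm, h'.mul_comm]
  · intro f hf
    have a1 : endConj k q i f = 0 := by
      refine h.nondegenerate _ fun g => ?_
      have := hf (endConj k i q g)
      have z1 : endConj k q i (endConj k i q g) = g := by ext x; simp [hq]
      have z2 : endConj k q' i' (endConj k i q g) = 0 := by ext x; simp [hqi']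
      simpa [hm, hm', z1, z2] using this
    have a2 : endConj k q' i' f = 0 := by
      refine h'.nondegenerate _ fun g => ?_
      have := hf (endConj k i' q' g)
      have z1 : endConj k q' i' (endConj k i' q' g) = g := by ext x; simp [hq']
      have z2 : endConj k q i (endConj k i' q' g) = 0 := by ext x; simp [hqi]
      simpa [hm, hm', z1, z2] using this
    ext x
    have b1 : q (f (i (q x))) = 0 := LinearMap.congr_fun a1 (q x)
    have b2 : q' (f (i' (q' x))) = 0 := LinearMap.congr_fun a2 (q' x)
    rw [← hsum (f x), ← hq (q (f x)), ← hq' (q' (f x)), hcomm, hcomm', b1, b2]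
    simp

end SymmetricAlgebras

/-! ### Isotypic modules through idempotents of the endomorphism ring -/

section Isotypic

/-- A nonzero idempotent is primitive if its corner ring has only trivial idempotents. -/
structure IsPrimitiveIdempotent {R : Type*} [Ring R] (e : R) : Prop where
  isIdempotentElem : IsIdempotentElem e
  ne_zero : e ≠ 0
  primitive : ∀ a : R, IsIdempotentElem a → e * a = a → a * e = a → a = 0 ∨ a = e

/-- Any two primitive idempotents are equivalent. -/
def HasUniquePrimitiveClass (R : Type*) [Ring R] : Prop :=
  ∀ e e' : R, IsPrimitiveIdempotent e → IsPrimitiveIdempotent e' → ∃ u v, u * v = e ∧ v * u = e'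

theorem IsPrimitiveIdempotent.map {R S : Type*} [Ring R] [Ring S] (f : R ≃+* S) {e : R}
    (h : IsPrimitiveIdempotent e) : IsPrimitiveIdempotent (f e) := by
  refine ⟨h.1.map f, by simpa using h.2, fun a ha h1 h2 => ?_⟩
  have := h.3 (f.symm a) (ha.map f.symm)
    (f.injective (by simpa using h1)) (f.injective (by simpa using h2))
  rcases this with h | h
  · left; simpa using h
  · right; rw [← h]; simp

theorem HasUniquePrimitiveClass.of_ringEquiv {R S : Type*} [Ring R] [Ring S] (f : R ≃+* S)
    (h : HasUniquePrimitiveClass R) : HasUniquePrimitiveClass S := by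
  intro e e' he he'
  obtain ⟨u, v, h1, h2⟩ := h _ _ (he.map f.symm) (he'.map f.symm)
  exact ⟨f u, f v, by rw [← map_mul, h1]; simp, by rw [← map_mul, h2]; simp⟩

variable {R M N N' : Type*} [Ring R] [AddCommGroup M] [Module R M]
  [AddCommGroup N] [Module R N] [AddCommGroup N'] [Module R N']

theorem isIndecomposableModule_iff :
    IsIndecomposableModule R N ↔
      Nontrivial N ∧ ∀ f : Module.End R N, IsIdempotentElem f → f = 0 ∨ f = 1 := by
  refine and_congr_right fun _ => ⟨fun h f hf => ?_, fun h K K' hK => ?_⟩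
  · rcases h _ _ (LinearMap.IsIdempotentElem.isCompl hf) with h | h
    · left; exact LinearMap.range_eq_bot.mp h
    · right
      ext x
      have : f (f x - x) = 0 := by
        rw [map_sub, sub_eq_zero]; exact LinearMap.congr_fun hf x
      have := LinearMap.ker_eq_bot'.mp h _ this
      simpa [sub_eq_zero] using this
  · have hp : IsIdempotentElem (Submodule.projection K K' hK) :=
      Submodule.isIdempotentElem_projection hK
    rcases h _ hp with h | h
    · left
      rw [← Submodule.range_projection hK, h, LinearMap.range_zero]
    · right
      rw [← Submodule.ker_projection hK, h]
      exact LinearMap.ker_id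

theorem isIndecomposableModule_iff_retract (i : N →ₗ[R] M) (q : M →ₗ[R] N)
    (hq : ∀ x, q (i x) = x) :
    IsIndecomposableModule R N ↔ IsPrimitiveIdempotent (i ∘ₗ q : Module.End R M) := by
  rw [isIndecomposableModule_iff]
  constructor
  · rintro ⟨hn, h⟩
    refine ⟨by ext x; simp [hq], ?_, fun a ha h1 h2 => ?_⟩
    · intro h0
      obtain ⟨x, hx⟩ := exists_ne (0 : N)
      apply hx
      have := congrArg q (LinearMap.congr_fun h0 (i x))
      simpa [hq] using this
    · have h1' : ∀ x, i (q (a x)) = a x := fun x => LinearMap.congr_fun h1 x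
      have h2' : ∀ x, a (i (q x)) = a x := fun x => LinearMap.congr_fun h2 x
      have ha' : ∀ x, a (a x) = a x := fun x => LinearMap.congr_fun ha x
      rcases h (q ∘ₗ a ∘ₗ i) (by ext x; simp [h1', ha']) with h | h
      · left
        ext x
        have := congrArg i (LinearMap.congr_fun h (q x))
        simpa [h1', h2'] using this
      · right
        ext x
        have := congrArg i (LinearMap.congr_fun h (q x))
        simpa [h1', h2'] using this
  · rintro ⟨-, h0, h⟩
    constructor
    · by_contra hn
      rw [not_nontrivial_iff_subsingleton] at hn
      apply h0
      ext x
      simp [Subsingleton.elim (q x) 0]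
    · intro f hf
      have hf' : ∀ x, f (f x) = f x := fun x => LinearMap.congr_fun hf x
      rcases h (i ∘ₗ f ∘ₗ q) (by ext x; simp [hq, hf']) (by ext x; simp [hq])
        (by ext x; simp [hq]) with h | h
      · left
        ext x
        have := congrArg q (LinearMap.congr_fun h (i x))
        simpa [hq] using this
      · right
        ext x
        have := congrArg q (LinearMap.congr_fun h (i x))
        simpa [hq] using this

/-- Equivalent idempotents have isomorphic images: `q' v i` and `q u i'` are mutually inverse. -/
theorem HasUniquePrimitiveClass.nonempty_linearEquiv (h : HasUniquePrimitiveClass (Module.End R M))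
    (i : N →ₗ[R] M) (q : M →ₗ[R] N) (hq : ∀ x, q (i x) = x)
    (i' : N' →ₗ[R] M) (q' : M →ₗ[R] N') (hq' : ∀ x, q' (i' x) = x)
    (hN : IsIndecomposableModule R N) (hN' : IsIndecomposableModule R N') :
    Nonempty (N ≃ₗ[R] N') := by
  obtain ⟨u, v, h1, h2⟩ := h _ _ ((isIndecomposableModule_iff_retract i q hq).mp hN)
    ((isIndecomposableModule_iff_retract i' q' hq').mp hN')
  have h1' : ∀ x, u (v x) = i (q x) := fun x => LinearMap.congr_fun h1 x
  have h2' : ∀ x, v (u x) = i' (q' x) := fun x => LinearMap.congr_fun h2 x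
  refine ⟨LinearEquiv.ofLinearMap (q' ∘ₗ v ∘ₗ i) (q ∘ₗ u ∘ₗ i') ?_ ?_⟩
  · ext x; simp [← h1', h2', hq']
  · ext x; simp [← h2', h1', hq]

theorem exists_retraction {N C : Submodule R M} (h : IsCompl N C) :
    ∃ q : M →ₗ[R] N, ∀ x, q (N.subtype x) = x :=
  ⟨N.projectionOnto C h, fun x => Submodule.projectionOnto_apply_left h x⟩

/-- The right side mentions only the ring `End M`, so isotypy can be transported between modules
over different rings. -/
theorem isIsotypicModule_iff :
    IsIsotypicModule R M ↔ HasUniquePrimitiveClass (Module.End R M) := by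
  constructor
  · intro h e e' he he'
    have hr : ∀ {e : Module.End R M}, IsIdempotentElem e →
        ∀ x, e.rangeRestrict ((LinearMap.range e).subtype x) = x := by
      rintro e he ⟨_, y, rfl⟩
      exact Subtype.ext (LinearMap.congr_fun he y)
    have hi : ∀ {e : Module.End R M}, IsPrimitiveIdempotent e →
        IsIndecomposableModule R (LinearMap.range e) := fun {e} he => by
      rw [isIndecomposableModule_iff_retract (LinearMap.range e).subtype e.rangeRestrict (hr he.1)]
      exact he
    obtain ⟨f⟩ := h (LinearMap.range e) (LinearMap.range e')
      ⟨_, LinearMap.IsIdempotentElem.isCompl he.1⟩ ⟨_, LinearMap.IsIdempotentElem.isCompl he'.1⟩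
      (hi he) (hi he')
    refine ⟨(LinearMap.range e).subtype ∘ₗ f.symm.toLinearMap ∘ₗ e'.rangeRestrict,
      (LinearMap.range e').subtype ∘ₗ f.toLinearMap ∘ₗ e.rangeRestrict, ?_, ?_⟩
    · ext x
      have := hr he'.1 (f (e.rangeRestrict x))
      simp only [Module.End.mul_apply, LinearMap.comp_apply, this, LinearEquiv.coe_coe]
      simp
    · ext x
      have := hr he.1 (f.symm (e'.rangeRestrict x))
      simp only [Module.End.mul_apply, LinearMap.comp_apply, this, LinearEquiv.coe_coe]
      simp
  · rintro h N N' ⟨C, hC⟩ ⟨C', hC'⟩ hN hN'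
    obtain ⟨q, hq⟩ := exists_retraction hC
    obtain ⟨q', hq'⟩ := exists_retraction hC'
    exact h.nonempty_linearEquiv _ q hq _ q' hq' hN hN'

end Isotypic

/-! ### Nilpotent modules over `k[X]` -/

noncomputable section NilpotentModules

open Polynomial DirectSum

/-- The cyclic module `k[X] / (X ^ a)`. -/
abbrev NilpotentCyclic (k : Type*) [Field k] (a : ℕ) : Type _ :=
  k[X] ⧸ (Submodule.span k[X] {(X : k[X]) ^ a})

variable {k : Type*} [Field k]

namespace NilpotentCyclic

/-- The canonical generator of `k[X] / (X ^ a)`. -/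
def gen (k : Type*) [Field k] (a : ℕ) : NilpotentCyclic k a := Submodule.Quotient.mk 1

theorem exists_smul_gen {a : ℕ} (x : NilpotentCyclic k a) : ∃ p : k[X], p • gen k a = x := by
  obtain ⟨p, rfl⟩ := Submodule.Quotient.mk_surjective _ x
  exact ⟨p, by rw [gen, ← Submodule.Quotient.mk_smul]; simp⟩

theorem smul_gen_eq_zero {a : ℕ} {p : k[X]} : p • gen k a = 0 ↔ X ^ a ∣ p := by
  rw [gen, ← Submodule.Quotient.mk_smul, Submodule.Quotient.mk_eq_zero,
    Submodule.mem_span_singleton, smul_eq_mul, mul_one]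
  simp only [smul_eq_mul, dvd_def, mul_comm, eq_comm]

theorem pow_smul {a b : ℕ} (h : a ≤ b) (x : NilpotentCyclic k a) : (X : k[X]) ^ b • x = 0 := by
  obtain ⟨p, rfl⟩ := exists_smul_gen x
  rw [smul_smul, smul_gen_eq_zero]
  exact (pow_dvd_pow X h).mul_right p

theorem end_eq_smul {a : ℕ} (f : Module.End k[X] (NilpotentCyclic k a)) :
    ∃ p : k[X], f = p • 1 := by
  obtain ⟨p, hp⟩ := exists_smul_gen (f (gen k a))
  refine ⟨p, LinearMap.ext fun x => ?_⟩
  obtain ⟨q, rfl⟩ := exists_smul_gen x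
  rw [map_smul, ← hp]
  simp [smul_smul, mul_comm]

theorem smul_one_eq_zero {a : ℕ} {p : k[X]} :
    p • (1 : Module.End k[X] (NilpotentCyclic k a)) = 0 ↔ X ^ a ∣ p := by
  rw [← smul_gen_eq_zero]
  refine ⟨fun h => by simpa using LinearMap.congr_fun h (gen k a), fun h => ?_⟩
  refine LinearMap.ext fun x => ?_
  obtain ⟨q, rfl⟩ := exists_smul_gen x
  simp [h]

theorem nontrivial_iff {a : ℕ} : Nontrivial (NilpotentCyclic k a) ↔ a ≠ 0 := by
  constructor
  · rintro h rfl
    obtain ⟨x, hx⟩ := exists_ne (0 : NilpotentCyclic k 0)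
    exact hx (by simpa using pow_smul le_rfl x)
  · intro h
    refine ⟨gen k a, 0, fun h0 => ?_⟩
    have : (X : k[X]) ^ a ∣ 1 := smul_gen_eq_zero.mp (by simpa using h0)
    exact not_isUnit_X (isUnit_of_dvd_one ((dvd_pow_self X h).trans this))

/-- The endomorphism ring is local: multiplication by `p` is nilpotent if `X` divides `p` and
invertible otherwise. -/
theorem isIndecomposableModule {a : ℕ} (ha : a ≠ 0) :
    IsIndecomposableModule k[X] (NilpotentCyclic k a) := by
  rw [isIndecomposableModule_iff]
  refine ⟨nontrivial_iff.mpr ha, fun f hf => ?_⟩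
  obtain ⟨p, rfl⟩ := end_eq_smul f
  by_cases hp : (X : k[X]) ∣ p
  · left
    rw [← hf.pow_eq ha, _root_.smul_pow, one_pow, smul_one_eq_zero]
    exact pow_dvd_pow_of_dvd hp a
  · right
    obtain ⟨u, v, huv⟩ : IsCoprime (X ^ a) p :=
      IsCoprime.pow_left ((irreducible_X.coprime_iff_not_dvd).mpr hp)
    have h1 : v • (p • (1 : Module.End k[X] (NilpotentCyclic k a))) = 1 := by
      have h2 : (u * X ^ a + v * p) • (1 : Module.End k[X] (NilpotentCyclic k a)) = 1 := by
        rw [huv, one_smul]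
      rwa [add_smul, smul_one_eq_zero.mpr (Dvd.intro_left u rfl), zero_add, mul_smul] at h2
    have h3 : v • ((p • (1 : Module.End k[X] (NilpotentCyclic k a))) * (p • 1)) = 1 := by
      rw [hf.eq, h1]
    rwa [← smul_mul_assoc, h1, one_mul] at h3

end NilpotentCyclic

/-- Every nonzero ideal of `k[X]/(X^a)` contains the socle, spanned by `X ^ (a - 1)`. Write `p = X ^
j * r` with `r` prime to `X`; then `c` is the constant term of `r`. -/
theorem Polynomial.exists_mul_sub_dvd_of_not_dvd {a : ℕ} {p : k[X]} (h : ¬ X ^ a ∣ p) :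
    ∃ (q : k[X]) (c : k), c ≠ 0 ∧ X ^ a ∣ p * q - C c * X ^ (a - 1) := by
  have hp : p ≠ 0 := by rintro rfl; exact h (dvd_zero _)
  obtain ⟨j, r, hr, rfl⟩ := WfDvdMonoid.max_power_factor hp irreducible_X
  have hj : j < a := by
    by_contra hj
    exact h ((pow_dvd_pow X (not_lt.mp hj)).mul_right r)
  refine ⟨X ^ (a - 1 - j), r.coeff 0, by rwa [Ne, ← X_dvd_iff], ?_⟩
  obtain ⟨s, hs⟩ : X ∣ r - C (r.coeff 0) := by simp [X_dvd_iff]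
  refine ⟨s, ?_⟩
  have e1 : (X : k[X]) ^ (a - 1) = X ^ j * X ^ (a - 1 - j) := by rw [← pow_add]; congr 1; omega
  have e2 : (X : k[X]) ^ a = X ^ (a - 1) * X := by rw [← pow_succ]; congr 1; omega
  linear_combination X ^ (a - 1) * hs - r * e1 - s * e2

/-- The algebra is commutative with a one-dimensional socle meeting every nonzero ideal, so any
functional nonzero on the socle works. -/
theorem NilpotentCyclic.exists_isSymmetrizingForm {a : ℕ} (ha : a ≠ 0) :
    ∃ l : Module.End k[X] (NilpotentCyclic k a) →ₗ[k] k, IsSymmetrizingForm k l := by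
  have hs : (X : k[X]) ^ (a - 1) • (1 : Module.End k[X] (NilpotentCyclic k a)) ≠ 0 := by
    rw [Ne, smul_one_eq_zero, pow_dvd_pow_iff X_ne_zero not_isUnit_X]
    omega
  have : Module.Free k (Module.End k[X] (NilpotentCyclic k a)) := .of_divisionRing _ _
  obtain ⟨l, hl⟩ : ∃ l : Module.Dual k (Module.End k[X] (NilpotentCyclic k a)),
      l ((X : k[X]) ^ (a - 1) • 1) ≠ 0 := by
    by_contra! hn
    exact hs ((Module.forall_dual_apply_eq_zero_iff k _).mp hn)
  refine ⟨l, fun f g => ?_, fun f hf => ?_⟩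
  · obtain ⟨p, rfl⟩ := end_eq_smul f
    obtain ⟨q, rfl⟩ := end_eq_smul g
    rw [smul_mul_smul_comm, smul_mul_smul_comm, mul_comm p q]
  · obtain ⟨p, rfl⟩ := end_eq_smul f
    by_contra hp
    rw [smul_one_eq_zero] at hp
    obtain ⟨q, c, hc, hq⟩ := exists_mul_sub_dvd_of_not_dvd hp
    rw [← smul_one_eq_zero] at hq
    replace hq := sub_eq_zero.mp ((sub_smul (p * q) (C c * X ^ (a - 1))
      (1 : Module.End k[X] (NilpotentCyclic k a))).symm.trans hq)
    rw [mul_smul, mul_smul] at hq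
    have h2 := hf (q • 1)
    rw [smul_mul_smul_comm, mul_one, mul_smul, hq] at h2
    have h3 : (C c : k[X]) • (X : k[X]) ^ (a - 1) • (1 : Module.End k[X] (NilpotentCyclic k a))
        = c • (X : k[X]) ^ (a - 1) • 1 := by
      refine LinearMap.ext fun x => ?_
      exact algebraMap_smul k[X] c ((X : k[X]) ^ (a - 1) • x)
    rw [h3, map_smul, smul_eq_mul, mul_eq_zero] at h2
    exact h2.elim hc hl

variable {W : Type*} [AddCommGroup W] [Module k W] [Module k[X] W] [IsScalarTower k k[X] W]

theorem exists_equiv_directSum_nilpotentCyclic [FiniteDimensional k W] {n : ℕ}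
    (h : ∀ w : W, (X : k[X]) ^ n • w = 0) :
    ∃ (d : ℕ) (e : Fin d → ℕ), Nonempty (W ≃ₗ[k[X]] ⨁ i, NilpotentCyclic k (e i)) := by
  have : Module.Finite k[X] W := Module.Finite.of_restrictScalars_finite k k[X] W
  exact Module.torsion_by_prime_power_decomposition irreducible_X
    (fun {w} => ⟨⟨X ^ n, n, rfl⟩, h w⟩)

theorem IsIndecomposableModule.exists_equiv_nilpotentCyclic [FiniteDimensional k W] {n : ℕ}
    (h : ∀ w : W, (X : k[X]) ^ n • w = 0) (hW : IsIndecomposableModule k[X] W) :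
    ∃ a, a ≠ 0 ∧ Nonempty (W ≃ₗ[k[X]] NilpotentCyclic k a) := by
  obtain ⟨d, e, ⟨f⟩⟩ := exists_equiv_directSum_nilpotentCyclic h
  obtain ⟨hW, hid⟩ := isIndecomposableModule_iff.mp hW
  have hf : ∃ i, (DirectSum.component k[X] (Fin d) (fun i => NilpotentCyclic k (e i)) i) ∘ₗ
      f.toLinearMap ≠ 0 := by
    by_contra! hn
    obtain ⟨w, hw⟩ := exists_ne (0 : W)
    apply hw
    apply f.injective
    rw [map_zero]
    ext i : 1
    exact LinearMap.congr_fun (hn i) w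
  obtain ⟨i, hi⟩ := hf
  set q : W →ₗ[k[X]] NilpotentCyclic k (e i) :=
    (DirectSum.component k[X] (Fin d) (fun i => NilpotentCyclic k (e i)) i) ∘ₗ f.toLinearMap with hq
  let j : NilpotentCyclic k (e i) →ₗ[k[X]] W :=
    f.symm.toLinearMap ∘ₗ DirectSum.lof k[X] (Fin d) (fun i => NilpotentCyclic k (e i)) i
  have hqj : ∀ x, q (j x) = x := by
    intro x
    simp [hq, j, DirectSum.component.lof_self]
  have hjq : (j ∘ₗ q : Module.End k[X] W) = 1 := by
    rcases hid (j ∘ₗ q) (by ext x; simp [hqj]) with h0 | h1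
    · exfalso
      apply hi
      ext x
      have := congrArg q (LinearMap.congr_fun h0 x)
      simpa [hqj] using this
    · exact h1
  let g : W ≃ₗ[k[X]] NilpotentCyclic k (e i) :=
    LinearEquiv.ofLinearMap q j (LinearMap.ext hqj) hjq
  refine ⟨e i, ?_, ⟨g⟩⟩
  rw [← NilpotentCyclic.nontrivial_iff (k := k)]
  exact g.symm.toEquiv.nontrivial

/-- The functional `l` cannot be nondegenerate if `W` has `k[X]/(X^a)` and `k[X]/(X^b)`, `a < b`,
as retracts: it kills the socle of the longer one. -/
theorem IsSymmetrizingForm.le_of_retract {l : Module.End k[X] W →ₗ[k] k}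
    (h : IsSymmetrizingForm k l) {a b : ℕ} (ha : a ≠ 0) (hb : b ≠ 0)
    (i : NilpotentCyclic k a →ₗ[k[X]] W) (q : W →ₗ[k[X]] NilpotentCyclic k a)
    (hq : ∀ x, q (i x) = x)
    (i' : NilpotentCyclic k b →ₗ[k[X]] W) (q' : W →ₗ[k[X]] NilpotentCyclic k b)
    (hq' : ∀ x, q' (i' x) = x) : b ≤ a := by
  by_contra! hab
  have hdvd : (X : k[X]) ^ b ∣ X ^ a * X ^ (b - a) := by
    rw [← pow_add]; exact pow_dvd_pow X (by omega)
  let f : NilpotentCyclic k a →ₗ[k[X]] NilpotentCyclic k b :=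
    Submodule.liftQ _ (LinearMap.toSpanSingleton k[X] _ (X ^ (b - a) • NilpotentCyclic.gen k b)) <| by
      rw [Submodule.span_le, Set.singleton_subset_iff, SetLike.mem_coe, LinearMap.mem_ker,
        LinearMap.toSpanSingleton_apply, smul_smul, NilpotentCyclic.smul_gen_eq_zero]
      exact hdvd
  let g : NilpotentCyclic k b →ₗ[k[X]] NilpotentCyclic k a :=
    Submodule.liftQ _ (LinearMap.toSpanSingleton k[X] _ (NilpotentCyclic.gen k a)) <| by
      rw [Submodule.span_le, Set.singleton_subset_iff, SetLike.mem_coe, LinearMap.mem_ker,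
        LinearMap.toSpanSingleton_apply]
      exact NilpotentCyclic.pow_smul hab.le _
  have hf : f (NilpotentCyclic.gen k a) = (X : k[X]) ^ (b - a) • NilpotentCyclic.gen k b := by
    have : f (NilpotentCyclic.gen k a) =
      (1 : k[X]) • (X : k[X]) ^ (b - a) • NilpotentCyclic.gen k b := rfl
    rw [this, one_smul]
  have hg : g (NilpotentCyclic.gen k b) = NilpotentCyclic.gen k a := by
    have : g (NilpotentCyclic.gen k b) = (1 : k[X]) • NilpotentCyclic.gen k a := rfl
    rw [this, one_smul]
  have hfg : ∀ x, f (g x) = (X : k[X]) ^ (b - a) • x := by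
    intro x
    obtain ⟨p, rfl⟩ := NilpotentCyclic.exists_smul_gen x
    rw [map_smul, hg, map_smul, hf, smul_comm]
  have hgf : ∀ x, g (f x) = (X : k[X]) ^ (b - a) • x := by
    intro x
    obtain ⟨p, rfl⟩ := NilpotentCyclic.exists_smul_gen x
    rw [map_smul, hf, map_smul, map_smul, hg, smul_comm]
  -- The map of the longer summand onto its socle.
  let s : Module.End k[X] W := i' ∘ₗ ((X : k[X]) ^ (b - 1) • 1 : Module.End k[X] _) ∘ₗ q'
  have hls : ∀ m : k[X], l (m • s) = 0 := by
    intro m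
    -- Since `fg` is `X ^ (b - a)`, the map `m • s` factors through the shorter summand. The
    -- opposite product acts there through `X ^ (b - 1)`, which is zero as `b - 1 ≥ a`.
    have e1 : m • s = (i' ∘ₗ f ∘ₗ q : Module.End k[X] W) *
        (m • i ∘ₗ ((X : k[X]) ^ (a - 1) • 1 : Module.End k[X] _) ∘ₗ g ∘ₗ q') := by
      ext w
      simp only [s, LinearMap.smul_apply, LinearMap.comp_apply, Module.End.mul_apply, map_smul, hq,
        hfg, Module.End.one_apply, smul_smul]
      congr 1
      rw [mul_assoc, ← pow_add]
      congr 2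
      omega
    have e2 : (m • i ∘ₗ ((X : k[X]) ^ (a - 1) • 1 : Module.End k[X] _) ∘ₗ g ∘ₗ q') *
        (i' ∘ₗ f ∘ₗ q : Module.End k[X] W) = 0 := by
      ext w
      simp only [LinearMap.smul_apply, LinearMap.comp_apply, Module.End.mul_apply, hq', hgf,
        Module.End.one_apply, smul_smul, ← pow_add]
      rw [NilpotentCyclic.pow_smul (by omega)]
      simp
    rw [e1, h.mul_comm, e2, map_zero]
  -- As `P s = s`, the trace property gives `l (s φ) = l (s φ P)`, and `s φ P` is a multiple of `s`.
  have hs : s = 0 := by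
    refine h.nondegenerate _ fun φ => ?_
    let P : Module.End k[X] W := i' ∘ₗ q'
    have hPs : P * s = s := by ext w; simp [P, s, hq']
    obtain ⟨m, hm⟩ := NilpotentCyclic.end_eq_smul (q' ∘ₗ φ ∘ₗ i')
    have hm' : ∀ x, q' (φ (i' x)) = m • x := fun x => LinearMap.congr_fun hm x
    have e : s * φ * P = m • s := by
      ext w
      simp [s, P, hm', smul_comm m]
    calc l (s * φ) = l (P * (s * φ)) := by rw [← mul_assoc, hPs]
      _ = 0 := by rw [h.mul_comm, e, hls]
  have h1 := congrArg q' (LinearMap.congr_fun hs (i' (NilpotentCyclic.gen k b)))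
  simp only [s, LinearMap.comp_apply, hq', LinearMap.smul_apply, Module.End.one_apply,
    LinearMap.zero_apply, map_zero] at h1
  rw [NilpotentCyclic.smul_gen_eq_zero, pow_dvd_pow_iff X_ne_zero not_isUnit_X] at h1
  omega

theorem isSymmetricAlg_end_iff_isIsotypicModule_of_nilpotent [FiniteDimensional k W] {n : ℕ}
    (h : ∀ w : W, (X : k[X]) ^ n • w = 0) :
    IsSymmetricAlg k (Module.End k[X] W) ↔ IsIsotypicModule k[X] W := by
  have : FiniteDimensional k (Module.End k[X] W) := finiteDimensional_moduleEnd W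
  constructor
  · rw [isSymmetricAlg_iff]
    rintro ⟨l, hl⟩ N N' ⟨D, hD⟩ ⟨D', hD'⟩ hN hN'
    obtain ⟨q, hq⟩ := exists_retraction hD
    obtain ⟨q', hq'⟩ := exists_retraction hD'
    have hfd : ∀ N : Submodule k[X] W, FiniteDimensional k N := fun N =>
      inferInstanceAs (FiniteDimensional k (N.restrictScalars k))
    obtain ⟨a, ha, ⟨f⟩⟩ := hN.exists_equiv_nilpotentCyclic (k := k) (n := n)
      (fun w => Subtype.ext (h w))
    obtain ⟨b, hb, ⟨f'⟩⟩ := hN'.exists_equiv_nilpotentCyclic (k := k) (n := n)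
      (fun w => Subtype.ext (h w))
    have h1 := hl.le_of_retract ha hb (N.subtype ∘ₗ f.symm.toLinearMap) (f.toLinearMap ∘ₗ q)
      (fun x => by have := hq (f.symm x); simp_all) (N'.subtype ∘ₗ f'.symm.toLinearMap)
      (f'.toLinearMap ∘ₗ q') (fun x => by have := hq' (f'.symm x); simp_all)
    have h2 := hl.le_of_retract hb ha (N'.subtype ∘ₗ f'.symm.toLinearMap)
      (f'.toLinearMap ∘ₗ q') (fun x => by have := hq' (f'.symm x); simp_all)
      (N.subtype ∘ₗ f.symm.toLinearMap) (f.toLinearMap ∘ₗ q)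
      (fun x => by have := hq (f.symm x); simp_all)
    obtain rfl := le_antisymm h1 h2
    exact ⟨f.trans f'.symm⟩
  · intro hiso
    rw [isIsotypicModule_iff] at hiso
    obtain ⟨d, e, ⟨f⟩⟩ := exists_equiv_directSum_nilpotentCyclic h
    -- The decomposition may contain zero summands, of exponent `0`; they must be discarded before
    -- comparing lengths.
    by_cases he : ∀ i, e i = 0
    · have hs : ∀ i, Subsingleton (NilpotentCyclic k (e i)) := fun i => by
        rw [← not_nontrivial_iff_subsingleton, NilpotentCyclic.nontrivial_iff]
        simp [he i]
      have hW : Subsingleton W := f.toEquiv.subsingleton_congr.mpr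
        ⟨fun x y => by ext i : 1; exact Subsingleton.elim _ _⟩
      have : Subsingleton (Module.End k[X] W) := ⟨fun x y => by ext w; exact Subsingleton.elim _ _⟩
      exact isSymmetricAlg_of_subsingleton _ _
    · push Not at he
      obtain ⟨i₀, hi₀⟩ := he
      have heq : ∀ i : {i // e i ≠ 0},
          Nonempty (NilpotentCyclic k (e i) ≃ₗ[k[X]] NilpotentCyclic k (e i₀)) := by
        intro i
        have key : ∀ j x, ((DirectSum.component k[X] (Fin d) (fun i => NilpotentCyclic k (e i)) j)
            ∘ₗ f.toLinearMap) ((f.symm.toLinearMap ∘ₗ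
              DirectSum.lof k[X] (Fin d) (fun i => NilpotentCyclic k (e i)) j) x) = x := by
          intro j x
          simp [DirectSum.component.lof_self]
        exact hiso.nonempty_linearEquiv _ _ (key i) _ _ (key i₀)
          (NilpotentCyclic.isIndecomposableModule i.2) (NilpotentCyclic.isIndecomposableModule hi₀)
      let g := fun i => (heq i).some
      have hz : ∀ i, e i = 0 → ∀ x : NilpotentCyclic k (e i), x = 0 := by
        intro i hi x
        simpa [hi] using NilpotentCyclic.pow_smul (k := k) le_rfl x
      classical
      -- All nonzero summands are identified with one of them, so that `End W` becomes a matrix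
      -- algebra.
      let F : W →ₗ[k[X]] ({i // e i ≠ 0} → NilpotentCyclic k (e i₀)) :=
        LinearMap.pi fun i => (g i).toLinearMap ∘ₗ
          (DirectSum.component k[X] (Fin d) (fun i => NilpotentCyclic k (e i)) i) ∘ₗ f.toLinearMap
      have hF : ∀ w i, F w i = (g i) (f w i) := fun w i => rfl
      have hFb : Function.Bijective F := by
        constructor
        · rw [← LinearMap.ker_eq_bot, LinearMap.ker_eq_bot']
          intro w hw
          apply f.injective
          rw [map_zero]
          ext i : 1
          by_cases hi : e i = 0
          · exact (hz i hi _).trans (hz i hi _).symm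
          · have := congrFun hw ⟨i, hi⟩
            rw [hF] at this
            simpa using this
        · intro y
          let z : ⨁ i, NilpotentCyclic k (e i) := DFinsupp.equivFunOnFintype.symm
            fun i => if hi : e i = 0 then 0 else (g ⟨i, hi⟩).symm (y ⟨i, hi⟩)
          refine ⟨f.symm z, funext fun i => ?_⟩
          rw [hF, LinearEquiv.apply_symm_apply]
          have : z i = (g i).symm (y i) := dif_neg i.2
          rw [this, LinearEquiv.apply_symm_apply]
      let E := (LinearEquiv.ofBijective F hFb).conjAlgEquiv k
      obtain ⟨l, hl⟩ := NilpotentCyclic.exists_isSymmetrizingForm (k := k) hi₀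
      let E' := E.trans (endVecAlgEquivMatrixEnd {i // e i ≠ 0} k k[X] (NilpotentCyclic k (e i₀)))
      have hfd := Module.Finite.equiv E'.toLinearEquiv
      rw [E'.isSymmetricAlg_iff, isSymmetricAlg_iff]
      exact ⟨_, hl.matrix⟩

end NilpotentModules

/-! ### Restriction to the corner of a full idempotent -/

noncomputable section Corner

open Polynomial

variable {k A W : Type*} [Field k] [Ring A] [Algebra k A]
  [AddCommGroup W] [Module k W] [Module A W] [IsScalarTower k A W]

/-- For an idempotent `i`, the subspace `i W`. -/
def idempotentPart (k : Type*) {A : Type*} (W : Type*) [Field k] [Ring A] [Algebra k A]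
    [AddCommGroup W] [Module k W] [Module A W] [IsScalarTower k A W] (i : A) :
    Submodule k W where
  carrier := {w | i • w = w}
  add_mem' := fun {v w} hv hw => by
    rw [Set.mem_ofPred_eq] at *
    rw [smul_add, hv, hw]
  zero_mem' := smul_zero i
  smul_mem' := fun c w hw => by
    rw [Set.mem_ofPred_eq] at *
    rw [smul_comm, hw]

theorem mem_idempotentPart {i : A} {w : W} : w ∈ idempotentPart k W i ↔ i • w = w := Iff.rfl

/-- The action of an element `x` with `i x = x` on `i W`. -/
def cornerAction (k : Type*) {A : Type*} (W : Type*) [Field k] [Ring A] [Algebra k A]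
    [AddCommGroup W] [Module k W] [Module A W] [IsScalarTower k A W] {i x : A} (hx : i * x = x) :
    Module.End k (idempotentPart k W i) where
  toFun w := ⟨x • (w : W), by rw [mem_idempotentPart, smul_smul, hx]⟩
  map_add' v w := Subtype.ext (smul_add _ _ _)
  map_smul' c w := Subtype.ext (smul_comm _ _ _)

theorem commute_aeval_of_commute {i x : A} (h : Commute i x) (p : k[X]) :
    Commute i (aeval x p) := by
  induction p using Polynomial.induction_on' with
  | add p q hp hq => simpa using hp.add_right hq
  | monomial n c =>
    rw [aeval_monomial]
    exact (Algebra.commute_algebraMap_right c i).mul_right (h.pow_right n)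

variable {i x : A} (hx : i * x = x)

@[simp] theorem coe_cornerAction_apply (w : idempotentPart k W i) :
    (cornerAction k W hx w : W) = x • (w : W) := rfl

theorem coe_cornerAction_pow (n : ℕ) (w : idempotentPart k W i) :
    ((cornerAction k W hx ^ n) w : W) = x ^ n • (w : W) := by
  induction n generalizing w with
  | zero => simp
  | succ n ih => rw [pow_succ, Module.End.mul_apply, ih, pow_succ, mul_smul]; rfl

theorem coe_aeval_cornerAction (p : k[X]) (w : idempotentPart k W i) :
    (aeval (cornerAction k W hx) p w : W) = aeval x p • (w : W) := by
  induction p using Polynomial.induction_on' with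
  | add p q hp hq => simp [hp, hq, add_smul]
  | monomial n c =>
    simp [aeval_monomial, coe_cornerAction_pow, mul_smul, Module.algebraMap_end_apply]

/-- Restriction of endomorphisms of `W` to `i W`. -/
def cornerRestrict (f : Module.End A W) :
    Module.End k[X] (Module.AEval' (cornerAction k W hx)) :=
  LinearMap.ofAEval _ ((Module.AEval'.of (cornerAction k W hx)).toLinearMap ∘ₗ
    ((f.restrictScalars k).restrict (p := idempotentPart k W i) (q := idempotentPart k W i)
      fun w hw => by
        rw [mem_idempotentPart] at *
        rw [LinearMap.restrictScalars_apply, ← map_smul, hw])) fun w => by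
    refine Eq.trans ?_ (Module.AEval'.X_smul_of _ _).symm
    exact congrArg (Module.AEval'.of (cornerAction k W hx))
      (Subtype.ext (show f (x • (w : W)) = x • f (w : W) from map_smul f x _))

theorem coe_cornerRestrict (f : Module.End A W) (w : idempotentPart k W i) :
    ((Module.AEval'.of (cornerAction k W hx)).symm
      (cornerRestrict hx f (Module.AEval'.of _ w)) : W) = f w := rfl

/-- The restriction of endomorphisms of `W` to `i W` as an algebra homomorphism. -/
def cornerRestrictHom :
    Module.End A W →ₐ[k] Module.End k[X] (Module.AEval' (cornerAction k W hx)) :=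
  AlgHom.ofLinearMap
    { toFun := cornerRestrict hx
      map_add' := fun _ _ => rfl
      map_smul' := fun _ _ => rfl } rfl fun _ _ => rfl

/-- A Morita argument. By `hfull`, `W = A i W`, so an endomorphism is determined on `iW`; an
endomorphism `ψ` of `iW` extends by `w ↦ ∑ a_j ψ(i b_j w)`. -/
theorem bijective_cornerRestrictHom (hxi : x * i = x) (hi : IsIdempotentElem i)
    (hgen : ∀ y : A, ∃ p : k[X], i * y * i = i * aeval x p)
    {ι : Type*} [Fintype ι] (a b : ι → A) (hfull : ∀ w : W, ∑ j, a j • i • b j • w = w) :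
    Function.Bijective (cornerRestrictHom (k := k) (W := W) hx) := by
  have hmem : ∀ w : W, i • w ∈ idempotentPart k W i := fun w => by
    rw [mem_idempotentPart, smul_smul, hi.eq]
  constructor
  · intro f g hfg
    ext w
    have h : ∀ w, f (i • w) = g (i • w) := fun w => by
      have e1 := coe_cornerRestrict (k := k) hx f ⟨i • w, hmem w⟩
      have e2 := coe_cornerRestrict (k := k) hx g ⟨i • w, hmem w⟩
      rw [show cornerRestrict (k := k) hx f = cornerRestrict hx g from hfg] at e1
      exact e1.symm.trans e2
    rw [← hfull w, map_sum, map_sum]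
    exact Finset.sum_congr rfl fun j _ => by rw [map_smul, h, ← map_smul]
  · intro ψ
    let of := Module.AEval'.of (cornerAction k W hx)
    let ψ' : idempotentPart k W i →ₗ[k] W := (idempotentPart k W i).subtype ∘ₗ
      of.symm.toLinearMap ∘ₗ ψ.restrictScalars k ∘ₗ of.toLinearMap
    have hiψ : ∀ v, i • ψ' v = ψ' v := fun v => (of.symm (ψ (of v))).2
    have hψp : ∀ (p : k[X]) (v w : idempotentPart k W i), (w : W) = aeval x p • (v : W) → ψ' w = aeval x p • ψ' v := by
      intro p v w hw
      have hw' : of w = p • of v := by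
        rw [← Module.AEval.of_aeval_smul]
        congr 1
        exact Subtype.ext (hw.trans (coe_aeval_cornerAction hx p v).symm)
      change ((of.symm (ψ (of w)) : idempotentPart k W i) : W) = _
      rw [hw', map_smul, Module.AEval.of_symm_smul]
      exact coe_aeval_cornerAction hx p _
    let r : A → W →ₗ[k] idempotentPart k W i := fun b =>
      { toFun := fun w => ⟨i • b • w, hmem _⟩
        map_add' := fun v w => Subtype.ext (by simp)
        map_smul' := fun c w => Subtype.ext (by simp [smul_comm _ c]) }
    have hr : ∀ b w, (r b w : W) = i • b • w := fun b w => rfl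
    -- On `iW` the element `iyi` acts as a polynomial in `x`, so `k[X]`-linearity is linearity over
    -- the whole corner.
    have hψ : ∀ (y : A) (v : idempotentPart k W i), ψ' (r y v) = i • y • ψ' v := by
      intro y v
      obtain ⟨p, hp⟩ := hgen y
      have key : ∀ w : W, i • w = w → i • y • w = aeval x p • w := by
        intro w hw
        nth_rw 1 [← hw]
        rw [smul_smul, smul_smul, hp, (commute_aeval_of_commute (hx.trans hxi.symm) p).eq, mul_smul,
          hw]
      rw [key _ (hiψ v)]
      exact hψp p v _ (key _ v.2)
    let φ₀ : W →ₗ[k] W := ∑ j, (Algebra.lsmul k k W (a j)) ∘ₗ ψ' ∘ₗ r (b j)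
    have hφ₀ : ∀ w, φ₀ w = ∑ j, a j • ψ' (r (b j) w) := fun w => by simp [φ₀]
    -- Inserting `hfull` turns the action of `c` into corner elements, which `ψ'` respects; this
    -- yields the `A`-linearity of `φ₀`.
    have hrA : ∀ c y w, r (y * c) w = ∑ l, r (y * c * a l) (r (b l) w) := by
      intro c y w
      apply Subtype.ext
      rw [AddSubmonoidClass.coe_finsetSum]
      simp only [hr]
      conv_lhs => rw [← hfull w]
      simp only [Finset.smul_sum, smul_smul, mul_assoc]
    let φ : Module.End A W :=
      { toFun := φ₀
        map_add' := map_add φ₀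
        map_smul' := fun c w => by
          rw [hφ₀, hφ₀, RingHom.id_apply, Finset.smul_sum]
          have e1 : ∀ j, r (b j) (c • w) = ∑ l, r (b j * c * a l) (r (b l) w) := fun j => by
            rw [← hrA]
            exact Subtype.ext (by rw [hr, hr, mul_smul])
          simp only [e1, map_sum, hψ, Finset.smul_sum]
          rw [Finset.sum_comm]
          refine Finset.sum_congr rfl fun l _ => ?_
          rw [← hfull (c • a l • ψ' (r (b l) w))]
          simp only [mul_smul] }
    refine ⟨φ, ?_⟩
    apply LinearMap.ext
    intro v
    obtain ⟨v, rfl⟩ := of.surjective v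
    apply of.symm.injective
    apply Subtype.ext
    refine (coe_cornerRestrict hx φ v).trans ?_
    change φ₀ v = ψ' v
    rw [hφ₀]
    simp only [hψ]
    exact hfull _

end Corner

/-! ### Idempotents in semisimple rings -/

section SemisimpleRings

/-- The projection of `R` onto `I` along a complement is right multiplication by its value at `1`.
-/
theorem IsSemisimpleRing.exists_isIdempotentElem_span {R : Type*} [Ring R] [IsSemisimpleRing R]
    (I : Ideal R) : ∃ f ∈ I, ∀ y ∈ I, y * f = y := by
  obtain ⟨C, hC⟩ := exists_isCompl I
  let q := I.projectionOnto C hC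
  refine ⟨q 1, (q 1).2, fun y hy => ?_⟩
  have h1 : q (y * 1) = y • q 1 := by rw [← smul_eq_mul, map_smul]
  rw [mul_one] at h1
  have h2 : (q y : R) = y := congrArg Subtype.val (Submodule.projectionOnto_apply_left hC ⟨y, hy⟩)
  rw [h1] at h2
  exact h2

theorem IsSemisimpleRing.exists_mul_mul_eq_self {R : Type*} [Ring R] [IsSemisimpleRing R] (a : R) :
    ∃ t, a * t * a = a := by
  obtain ⟨f, hf, h⟩ := exists_isIdempotentElem_span (Ideal.span {a})
  obtain ⟨t, rfl⟩ := Ideal.mem_span_singleton'.mp hf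
  exact ⟨t, by rw [mul_assoc]; exact h a (Ideal.mem_span_singleton_self a)⟩

/-- The opposite ring supplies a left identity `f'`, and `f' = f' f = f`. -/
theorem IsSemisimpleRing.exists_identity {R : Type*} [Ring R] [IsSemisimpleRing R] (I : Ideal R)
    (hI : ∀ y ∈ I, ∀ r, y * r ∈ I) : ∃ f ∈ I, ∀ y ∈ I, y * f = y ∧ f * y = y := by
  obtain ⟨f, hf, h⟩ := exists_isIdempotentElem_span I
  let I' : Ideal Rᵐᵒᵖ :=
    { carrier := {y | y.unop ∈ I}
      add_mem' := fun hx hy => I.add_mem hx hy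
      zero_mem' := I.zero_mem
      smul_mem' := fun r y hy => hI _ hy r.unop }
  obtain ⟨f', hf', h'⟩ := exists_isIdempotentElem_span I'
  have h1 : ∀ y ∈ I, f'.unop * y = y := fun y hy =>
    congrArg MulOpposite.unop (h' (MulOpposite.op y) hy)
  have h2 : f'.unop = f := (h _ hf').symm.trans (h1 _ hf)
  exact ⟨f, hf, fun y hy => ⟨h y hy, h2 ▸ h1 y hy⟩⟩

/-- By Wedderburn–Artin over an algebraically closed field, the diagonal matrix units serve. -/
theorem exists_sum_rank_one_idempotents (k S : Type*) [Field k] [IsAlgClosed k] [Ring S]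
    [Algebra k S] [FiniteDimensional k S] [IsSemisimpleRing S] :
    ∃ (ι : Type) (_ : Fintype ι) (f : ι → S), ∑ j, f j = 1 ∧
      ∀ j, f j * f j = f j ∧ ∀ s, ∃ c : k, f j * s * f j = c • f j := by
  classical
  obtain ⟨n, d, hd, ⟨e⟩⟩ := IsSemisimpleRing.exists_algEquiv_pi_matrix_of_isAlgClosed k S
  let E : (Σ r : Fin n, Fin (d r)) → Π r, Matrix (Fin (d r)) (Fin (d r)) k :=
    fun j => Pi.single j.1 (Matrix.single j.2 j.2 1)
  refine ⟨_, inferInstance, fun j => e.symm (E j), ?_, fun j => ⟨?_, fun s => ?_⟩⟩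
  · rw [← map_sum, ← map_one e.symm]
    congr 1
    rw [Fintype.sum_sigma]
    simp only [E]
    have h1 : ∀ r : Fin n, ∑ c : Fin (d r), (Pi.single r (Matrix.single c c 1) :
        Π r, Matrix (Fin (d r)) (Fin (d r)) k) = Pi.single r 1 := fun r => by
      rw [← Matrix.sum_single_one]
      exact (map_sum (AddMonoidHom.single
        (fun r : Fin n => Matrix (Fin (d r)) (Fin (d r)) k) r) _ _).symm
    simp only [h1]
    exact Finset.univ_sum_single (1 : Π r, Matrix (Fin (d r)) (Fin (d r)) k)
  · rw [← map_mul]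
    congr 1
    simp only [E]
    rw [← Pi.single_mul, Matrix.single_mul_single_same, mul_one]
  · refine ⟨(e s) j.1 j.2 j.2, e.injective ?_⟩
    rw [map_mul, map_mul, map_smul, AlgEquiv.apply_symm_apply]
    ext r a b
    obtain ⟨r', c⟩ := j
    simp only [E, Pi.mul_apply, Pi.smul_apply]
    by_cases h : r = r'
    · subst h
      by_cases hac : c = a ∧ c = b
      · obtain ⟨rfl, rfl⟩ := hac
        simp
      · simp [hac]
    · simp [h]

end SemisimpleRings

/-! ### Corners of crossed extensions -/

section Crossed

open Polynomial

/-- A subalgebra `S` of `A` together with a group `G` acting on it by inner automorphisms of `A`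
coming from elements spanning `A`, such that the normal subgroup `N` lands in `S`. -/
structure IsCrossedExtension {k A G : Type*} [Field k] [Ring A] [Algebra k A] [Group G]
    (S : Subalgebra k A) (N : Subgroup G) (γ : G →* A) : Prop where
  mem_of_mem : ∀ n ∈ N, γ n ∈ S
  conj_mem : ∀ g, ∀ s ∈ S, γ g * s * γ g⁻¹ ∈ S
  span_eq_top : Submodule.span k (Set.range γ) = ⊤

variable {k A G : Type*} [Field k] [Ring A] [Algebra k A] [Group G]
  {S : Subalgebra k A} {N : Subgroup G} {γ : G →* A}

/-- Elements of `i S g i`. -/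
def InCornerDegree (S : Subalgebra k A) (γ : G →* A) (i : A) (g : G) (y : A) : Prop :=
  ∃ a ∈ S, y = i * a * γ g * i

/-- An idempotent `i` of `S` with `i S i = k i`. -/
structure IsRankOneIdempotent (S : Subalgebra k A) (i : A) : Prop where
  mem : i ∈ S
  mul_self : i * i = i
  ne_zero : i ≠ 0
  corner : ∀ s ∈ S, ∃ c : k, i * s * i = c • i

variable {i : A}

theorem map_mul_map_inv_mul (γ : G →* A) (g : G) (x : A) : γ g * (γ g⁻¹ * x) = x := by
  rw [← mul_assoc, ← map_mul, mul_inv_cancel, map_one, one_mul]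

theorem map_inv_mul_map_mul (γ : G →* A) (g : G) (x : A) : γ g⁻¹ * (γ g * x) = x := by
  rw [← mul_assoc, ← map_mul, inv_mul_cancel, map_one, one_mul]

theorem map_mul_map_inv (γ : G →* A) (g : G) : γ g * γ g⁻¹ = 1 := by
  rw [← map_mul, mul_inv_cancel, map_one]

theorem map_inv_mul_map (γ : G →* A) (g : G) : γ g⁻¹ * γ g = 1 := by
  rw [← map_mul, inv_mul_cancel, map_one]

theorem IsCrossedExtension.inv_conj_mem (hS : IsCrossedExtension S N γ) (g : G) {s : A}
    (hs : s ∈ S) : γ g⁻¹ * s * γ g ∈ S := by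
  simpa using hS.conj_mem g⁻¹ s hs

namespace InCornerDegree

theorem left (hi : IsRankOneIdempotent S i) {g : G} {y : A} (h : InCornerDegree S γ i g y) :
    i * y = y := by
  obtain ⟨a, -, rfl⟩ := h
  simp only [← mul_assoc, hi.mul_self]

theorem right (hi : IsRankOneIdempotent S i) {g : G} {y : A} (h : InCornerDegree S γ i g y) :
    y * i = y := by
  obtain ⟨a, -, rfl⟩ := h
  rw [mul_assoc, hi.mul_self]

theorem one (hi : IsRankOneIdempotent S i) : InCornerDegree S γ i 1 i :=
  ⟨1, S.one_mem, by simp [hi.mul_self]⟩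

theorem mul (hS : IsCrossedExtension S N γ) (hi : IsRankOneIdempotent S i) {g h : G} {y z : A}
    (hy : InCornerDegree S γ i g y) (hz : InCornerDegree S γ i h z) :
    InCornerDegree S γ i (g * h) (y * z) := by
  obtain ⟨a, ha, rfl⟩ := hy
  obtain ⟨b, hb, rfl⟩ := hz
  refine ⟨a * (γ g * (i * (i * b)) * γ g⁻¹),
    S.mul_mem ha (hS.conj_mem g _ (S.mul_mem hi.mem (S.mul_mem hi.mem hb))), ?_⟩
  simp only [map_mul, mul_assoc, map_inv_mul_map_mul]

/-- The degree matters only modulo `N`, since `γ n` can be absorbed into `S`. -/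
theorem of_mul_mem (hS : IsCrossedExtension S N γ) {g n : G} {y : A}
    (hn : n ∈ N) (hy : InCornerDegree S γ i (g * n) y) : InCornerDegree S γ i g y := by
  obtain ⟨a, ha, rfl⟩ := hy
  refine ⟨a * (γ g * γ n * γ g⁻¹), S.mul_mem ha (hS.conj_mem g _ (hS.mem_of_mem n hn)), ?_⟩
  simp only [map_mul, mul_assoc, map_inv_mul_map_mul]

theorem exists_eq_smul_of_one (hi : IsRankOneIdempotent S i) {y : A}
    (hy : InCornerDegree S γ i 1 y) : ∃ c : k, y = c • i := by
  obtain ⟨a, ha, rfl⟩ := hy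
  simpa using hi.corner a ha

/-- Write `u = w γ(g)` with `w` in `iS`, and choose `t` with `w t w = w`. Then `w t i` is a scalar
multiple of `i` fixing `w`, hence equals `i`. This gives a right inverse `v`; `v u` is again a
scalar, forced to be `1` by `u v u = u`. -/
theorem exists_inv [IsSemisimpleRing S] (hS : IsCrossedExtension S N γ)
    (hi : IsRankOneIdempotent S i) {g : G} {u : A} (hu : InCornerDegree S γ i g u) (hu0 : u ≠ 0) :
    ∃ v, InCornerDegree S γ i g⁻¹ v ∧ u * v = i ∧ v * u = i := by
  have hui := hu.right hi
  obtain ⟨a, ha, hua⟩ := hu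
  have hw : i * a * (γ g * i * γ g⁻¹) ∈ S :=
    S.mul_mem (S.mul_mem hi.mem ha) (hS.conj_mem g _ hi.mem)
  set w := i * a * (γ g * i * γ g⁻¹) with hwdef
  have hwu : w * γ g = u := by
    simp only [hwdef, hua, mul_assoc, map_inv_mul_map, mul_one]
  have hiw : i * w = w := by simp only [hwdef, ← mul_assoc, hi.mul_self]
  have hw0 : w ≠ 0 := by rintro h; apply hu0; rw [← hwu, h, zero_mul]
  obtain ⟨⟨t, ht⟩, htw⟩ := IsSemisimpleRing.exists_mul_mul_eq_self (⟨w, hw⟩ : S)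
  replace htw : w * t * w = w := congrArg Subtype.val htw
  have hwt : w * t * i = i := by
    obtain ⟨c, hc⟩ := hi.corner _ (S.mul_mem hw ht)
    rw [← mul_assoc, hiw] at hc
    have h1 : c • w = w := by
      calc c • w = (w * t * i) * w := by rw [hc, smul_mul_assoc, hiw]
        _ = w := by rw [mul_assoc, hiw, htw]
    have h2 : (c - 1) • w = 0 := by rw [sub_smul, h1, one_smul, sub_self]
    rw [hc, sub_eq_zero.mp ((smul_eq_zero.mp h2).resolve_right hw0), one_smul]
  have huv : u * (i * γ g⁻¹ * t * i) = i := by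
    calc u * (i * γ g⁻¹ * t * i) = (u * i) * γ g⁻¹ * t * i := by simp only [mul_assoc]
      _ = i := by
        rw [hui, ← hwu]
        simpa only [mul_assoc, map_mul_map_inv_mul] using hwt
  refine ⟨i * γ g⁻¹ * t * i, ⟨γ g⁻¹ * t * γ g, hS.inv_conj_mem g ht, ?_⟩, huv, ?_⟩
  · simp only [mul_assoc, map_mul_map_inv_mul]
  · obtain ⟨d, hd⟩ := hi.corner _ (hS.inv_conj_mem g (S.mul_mem ht (S.mul_mem hi.mem hw)))
    have hvu : i * γ g⁻¹ * t * i * u = d • i := by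
      rw [← hd, ← hui, ← hwu]
      simp only [mul_assoc]
    have h1 : d • u = u := by
      calc d • u = u * (i * γ g⁻¹ * t * i * u) := by rw [hvu, mul_smul_comm, hui]
        _ = (u * (i * γ g⁻¹ * t * i)) * u := by simp only [mul_assoc]
        _ = u := by rw [huv, hua]; simp only [← mul_assoc, hi.mul_self]
    have h2 : (d - 1) • u = 0 := by rw [sub_smul, h1, one_smul, sub_self]
    rw [hvu, sub_eq_zero.mp ((smul_eq_zero.mp h2).resolve_right hu0), one_smul]

/-- If `v` inverts `u`, then `y v` has degree `1`, so it is a scalar multiple of `i`. -/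
theorem exists_eq_smul [IsSemisimpleRing S] (hS : IsCrossedExtension S N γ)
    (hi : IsRankOneIdempotent S i) {g : G} {u y : A} (hu : InCornerDegree S γ i g u) (hu0 : u ≠ 0)
    (hy : InCornerDegree S γ i g y) : ∃ c : k, y = c • u := by
  obtain ⟨v, hv, -, hvu⟩ := hu.exists_inv hS hi hu0
  have h1 := hy.mul hS hi hv
  rw [mul_inv_cancel] at h1
  obtain ⟨c, hc⟩ := h1.exists_eq_smul_of_one hi
  refine ⟨c, ?_⟩
  rw [← hy.right hi, ← hvu, ← mul_assoc, hc, smul_mul_assoc, hu.left hi]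

/-- The factor `i` matters only for `n = 0`, where it replaces `1` by the identity of the corner. -/
theorem pow (hS : IsCrossedExtension S N γ) (hi : IsRankOneIdempotent S i) {g : G} {u : A}
    (hu : InCornerDegree S γ i g u) (n : ℕ) : InCornerDegree S γ i (g ^ n) (i * u ^ n) := by
  induction n with
  | zero => simpa using one hi
  | succ n ih =>
    have := ih.mul hS hi hu
    rwa [← pow_succ, mul_assoc, ← pow_succ] at this

theorem mul_pow_ne_zero [IsSemisimpleRing S] (hS : IsCrossedExtension S N γ)
    (hi : IsRankOneIdempotent S i) {g : G} {u : A} (hu : InCornerDegree S γ i g u) (hu0 : u ≠ 0)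
    (n : ℕ) : i * u ^ n ≠ 0 := by
  obtain ⟨v, hv, huv, -⟩ := hu.exists_inv hS hi hu0
  induction n with
  | zero => simpa using hi.ne_zero
  | succ n ih =>
    intro h
    apply ih
    have h1 := congrArg (· * v) h
    simp only [pow_succ, zero_mul, mul_assoc, huv] at h1
    have hcomm : Commute i u := (hu.left hi).trans (hu.right hi).symm
    rwa [← (hcomm.pow_right n).eq, ← mul_assoc, hi.mul_self] at h1

end InCornerDegree

/-- The degrees occurring in the corner `i A i`. -/
def cornerSupport [IsSemisimpleRing S] (hS : IsCrossedExtension S N γ)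
    (hi : IsRankOneIdempotent S i) : Subgroup G where
  carrier := {g | ∃ u, InCornerDegree S γ i g u ∧ u ≠ 0}
  one_mem' := ⟨i, .one hi, hi.ne_zero⟩
  mul_mem' := by
    rintro g h ⟨u, hu, hu0⟩ ⟨w, hw, hw0⟩
    obtain ⟨v, hv, huv, hvu⟩ := hu.exists_inv hS hi hu0
    refine ⟨u * w, hu.mul hS hi hw, fun h0 => hw0 ?_⟩
    rw [← hw.left hi, ← hvu, mul_assoc, h0, mul_zero]
  inv_mem' := by
    rintro g ⟨u, hu, hu0⟩
    obtain ⟨v, hv, huv, -⟩ := hu.exists_inv hS hi hu0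
    exact ⟨v, hv, fun h0 => hi.ne_zero (by rw [← huv, h0, mul_zero])⟩

/-- The support has cyclic image in `G/N`; take `u` in a generating degree. Finiteness allows
natural exponents, and each component is a line, hence spanned by a power of `u`. -/
theorem exists_homogeneous_generator [IsSemisimpleRing S] [Finite G] [N.Normal] [IsCyclic (G ⧸ N)]
    (hS : IsCrossedExtension S N γ) (hi : IsRankOneIdempotent S i) :
    ∃ (h : G) (u : A), InCornerDegree S γ i h u ∧ u ≠ 0 ∧
      ∀ g y, InCornerDegree S γ i g y → ∃ (c : k) (n : ℕ), y = c • (i * u ^ n) := by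
  obtain ⟨⟨_, h, ⟨u, hu, hu0⟩, rfl⟩, hgen⟩ :=
    IsCyclic.exists_monoid_generator (α := (cornerSupport hS hi).map (QuotientGroup.mk' N))
  refine ⟨h, u, hu, hu0, fun g y hy => ?_⟩
  by_cases hy0 : y = 0
  · exact ⟨0, 0, by simp [hy0]⟩
  obtain ⟨n, hn⟩ := hgen ⟨_, g, ⟨y, hy, hy0⟩, rfl⟩
  have hn' : ((h ^ n : G) : G ⧸ N) = g := congrArg Subtype.val hn
  rw [QuotientGroup.eq] at hn'
  rw [← mul_inv_cancel_left (h ^ n) g] at hy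
  obtain ⟨c, hc⟩ := (hu.pow hS hi n).exists_eq_smul hS hi (hu.mul_pow_ne_zero hS hi hu0 n)
    (hy.of_mul_mem hS hn')
  exact ⟨c, n, hc⟩

/-- The corner `i A i` is generated by one nilpotent element. -/
theorem IsRankOneIdempotent.exists_nilpotent_generator [IsAlgClosed k] (p : ℕ) [Fact p.Prime]
    [CharP k p] [IsSemisimpleRing S] [Finite G] [N.Normal] [IsCyclic (G ⧸ N)]
    {m : ℕ} (hm : N.index = p ^ m)
    (hS : IsCrossedExtension S N γ) (hi : IsRankOneIdempotent S i) :
    ∃ (x : A) (n : ℕ), i * x = x ∧ x * i = x ∧ x ^ n = 0 ∧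
      ∀ y, ∃ q : k[X], i * y * i = i * aeval x q := by
  obtain ⟨h, u, hu, hu0, hgen⟩ := exists_homogeneous_generator hS hi
  have hq0 : p ^ m ≠ 0 := pow_ne_zero _ (Fact.out : p.Prime).ne_zero
  have hiu := hu.left hi
  have hui := hu.right hi
  have hcomm : Commute i u := hiu.trans hui.symm
  have hiq : ∀ n, n ≠ 0 → i ^ n = i := fun n hn => IsIdempotentElem.pow_eq hi.mul_self hn
  obtain ⟨c, hc⟩ : ∃ c : k, i * u ^ p ^ m = c • i := by
    have h1 := hu.pow hS hi (p ^ m)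
    have h2 : h ^ p ^ m ∈ N := by
      rw [← QuotientGroup.eq_one_iff, QuotientGroup.mk_pow, ← hm, N.index_eq_card]
      exact pow_card_eq_one'
    rw [← one_mul (h ^ p ^ m)] at h1
    exact (h1.of_mul_mem hS h2).exists_eq_smul_of_one hi
  have hc0 : c ≠ 0 := by
    rintro rfl
    exact hu.mul_pow_ne_zero hS hi hu0 _ (by rw [hc, zero_smul])
  have hupow : u ^ p ^ m = c • i := by
    rw [← hc]
    obtain ⟨n, hn⟩ := Nat.exists_eq_succ_of_ne_zero hq0
    rw [hn, pow_succ', ← mul_assoc, hiu]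
  -- With `d ^ (p ^ m) = c`, Frobenius makes `d⁻¹ • u - i` nilpotent: its power of exponent `p ^ m`
  -- is `i - i`.
  obtain ⟨d, hd⟩ := IsAlgClosed.exists_pow_nat_eq c (Nat.pos_of_ne_zero hq0)
  have hd0 : d ≠ 0 := by
    rintro rfl
    exact hc0 (by rw [← hd, zero_pow hq0])
  have : Nontrivial A := ⟨i, 0, hi.ne_zero⟩
  have : CharP A p := charP_of_injective_algebraMap (algebraMap k A).injective p
  have hix : i * (d⁻¹ • u - i) = d⁻¹ • u - i := by
    rw [mul_sub, mul_smul_comm, hiu, hi.mul_self]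
  have hxi : (d⁻¹ • u - i) * i = d⁻¹ • u - i := by
    rw [sub_mul, smul_mul_assoc, hui, hi.mul_self]
  refine ⟨d⁻¹ • u - i, p ^ m, hix, hxi, ?_, fun y => ?_⟩
  · rw [sub_pow_char_pow_of_commute _ _ (hcomm.symm.smul_left d⁻¹), _root_.smul_pow, hupow, hiq _ hq0,
      smul_smul, inv_pow, hd, inv_mul_cancel₀ hc0, one_smul, sub_self]
  · set x := d⁻¹ • u - i with hx
    have hud : u = i * (d • (x + 1)) := by
      rw [mul_smul_comm, mul_add, hix, mul_one, hx, sub_add_cancel, smul_smul, mul_inv_cancel₀ hd0,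
        one_smul]
    -- In the corner `u = d(x + i)`, so powers of `u` are polynomials in `x`.
    have hpow : ∀ n, i * u ^ n = i * aeval x ((C d * (X + 1)) ^ n) := by
      intro n
      have hw : aeval x (C d * (X + 1)) = d • (x + 1) := by
        simp [Algebra.smul_def]
      rw [map_pow, hw]
      induction n with
      | zero => simp
      | succ n ih =>
        rw [pow_succ', pow_succ', ← mul_assoc, ← mul_assoc, ← hud, hiu]
        calc u * u ^ n = u * (i * u ^ n) := by rw [← mul_assoc, hui]
          _ = u * (d • (x + 1)) ^ n := by rw [ih, ← mul_assoc, hui]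
    have hy : y ∈ Submodule.span k (Set.range γ) := by rw [hS.span_eq_top]; trivial
    induction hy using Submodule.span_induction with
    | mem y hy =>
      obtain ⟨g, rfl⟩ := hy
      obtain ⟨c, n, hcn⟩ := hgen g (i * 1 * γ g * i) ⟨1, S.one_mem, rfl⟩
      rw [mul_one] at hcn
      exact ⟨C c * (C d * (X + 1)) ^ n, by
        rw [hcn, hpow, map_mul, aeval_C, ← mul_smul_comm, Algebra.smul_def]⟩
    | zero => exact ⟨0, by simp⟩
    | add y z _ _ hy hz =>
      obtain ⟨q, hq⟩ := hy
      obtain ⟨r, hr⟩ := hz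
      exact ⟨q + r, by rw [mul_add, add_mul, hq, hr, map_add, mul_add]⟩
    | smul c y _ hy =>
      obtain ⟨q, hq⟩ := hy
      exact ⟨c • q, by rw [mul_smul_comm, smul_mul_assoc, hq, map_smul, mul_smul_comm]⟩

theorem IsCrossedExtension.mem_center (hS : IsCrossedExtension S N γ) {f : A}
    (hf : ∀ g, γ g * f = f * γ g) : f ∈ Subring.center A := by
  rw [Subring.mem_center_iff]
  intro y
  have hy : y ∈ Submodule.span k (Set.range γ) := by rw [hS.span_eq_top]; trivial
  induction hy using Submodule.span_induction with
  | mem y hy => obtain ⟨g, rfl⟩ := hy; exact hf g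
  | zero => simp
  | add y z _ _ hy hz => rw [add_mul, mul_add, hy, hz]
  | smul c y _ hy => rw [smul_mul_assoc, mul_smul_comm, hy]

/-- The two-sided ideal `A i A`. -/
def idealOfIdempotent (k : Type*) {A : Type*} [Field k] [Ring A] [Algebra k A] (i : A) :
    Submodule k A :=
  Submodule.span k {z | ∃ a b, z = a * i * b}

theorem mul_mul_mem_idealOfIdempotent {y : A} (hy : y ∈ idealOfIdempotent k i) (c d : A) :
    c * y * d ∈ idealOfIdempotent k i := by
  induction hy using Submodule.span_induction with
  | mem y hy =>
    obtain ⟨a, b, rfl⟩ := hy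
    exact Submodule.subset_span ⟨c * a, b * d, by simp only [mul_assoc]⟩
  | zero => simp
  | add y z _ _ hy hz => rw [mul_add, add_mul]; exact Submodule.add_mem _ hy hz
  | smul r y _ hy => rw [mul_smul_comm, smul_mul_assoc]; exact Submodule.smul_mem _ r hy

theorem exists_sum_of_mem_idealOfIdempotent {y : A} (hy : y ∈ idealOfIdempotent k i) :
    ∃ (n : ℕ) (a b : Fin n → A), ∑ j, a j * i * b j = y := by
  obtain ⟨n, f, g, hfg⟩ := Submodule.mem_span_set'.mp hy
  choose a b hab using fun j => (g j).2
  refine ⟨n, fun j => f j • a j, b, ?_⟩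
  rw [← hfg]
  exact Finset.sum_congr rfl fun j _ => by rw [hab, smul_mul_assoc, smul_mul_assoc]

/-- The two-sided ideal `S ∩ AiA` of `S` has an identity `f`. Conjugation by each `γ g` preserves
`S` and `AiA`, so it fixes `f` by uniqueness. -/
theorem IsCrossedExtension.exists_central_identity [IsSemisimpleRing S]
    (hS : IsCrossedExtension S N γ) (hi : i ∈ S) :
    ∃ f ∈ Subring.center A, f ∈ idealOfIdempotent k i ∧ IsIdempotentElem f ∧ f * i = i := by
  let I : Ideal S :=
    { carrier := {s | (s : A) ∈ idealOfIdempotent k i}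
      add_mem' := fun ha hb => (idealOfIdempotent k i).add_mem ha hb
      zero_mem' := (idealOfIdempotent k i).zero_mem
      smul_mem' := fun c s hs => by simpa using mul_mul_mem_idealOfIdempotent hs (c : A) 1 }
  obtain ⟨⟨f, hfS⟩, hfI, hf⟩ := IsSemisimpleRing.exists_identity I
    (fun y hy r => show ((y * r : S) : A) ∈ idealOfIdempotent k i by
      simpa using mul_mul_mem_idealOfIdempotent hy 1 (r : A))
  replace hfI : f ∈ idealOfIdempotent k i := hfI
  have hf1 : ∀ y ∈ S, y ∈ idealOfIdempotent k i → y * f = y := fun y hy hyI =>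
    congrArg Subtype.val (hf ⟨y, hy⟩ hyI).1
  have hf2 : ∀ y ∈ S, y ∈ idealOfIdempotent k i → f * y = y := fun y hy hyI =>
    congrArg Subtype.val (hf ⟨y, hy⟩ hyI).2
  refine ⟨f, hS.mem_center fun g => ?_, hfI, hf1 f hfS hfI,
    hf2 i hi (Submodule.subset_span ⟨1, 1, by simp⟩)⟩
  have h1 := hf1 _ (hS.conj_mem g f hfS) (mul_mul_mem_idealOfIdempotent hfI _ _)
  have h2 := hf2 _ (hS.inv_conj_mem g hfS) (mul_mul_mem_idealOfIdempotent hfI _ _)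
  have h3 := congrArg (fun y => γ g * y * γ g⁻¹) h2
  simp only [mul_assoc, map_mul_map_inv_mul, map_mul_map_inv, mul_one] at h3
  simp only [mul_assoc] at h1
  rw [h1] at h3
  have h4 := congrArg (fun y => y * γ g) h3
  simpa only [mul_assoc, map_inv_mul_map, mul_one] using h4

/-- Every block of `A` contains a full idempotent whose corner is generated by one nilpotent
element. -/
theorem IsBlockIdempotent.exists_full_corner [IsAlgClosed k] (p : ℕ) [Fact p.Prime]
    [CharP k p] [FiniteDimensional k A] [IsSemisimpleRing S] [Finite G] [N.Normal]
    [IsCyclic (G ⧸ N)] {m : ℕ} (hm : N.index = p ^ m) (hS : IsCrossedExtension S N γ)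
    {e : A} (he : IsBlockIdempotent e) :
    ∃ (i x : A) (n : ℕ), IsIdempotentElem i ∧ i * x = x ∧ x * i = x ∧ x ^ n = 0 ∧
      (∀ y, ∃ q : k[X], i * y * i = i * aeval x q) ∧
      ∃ (r : ℕ) (a b : Fin r → A), ∑ j, a j * i * b j = e := by
  have : FiniteDimensional k S := FiniteDimensional.finiteDimensional_submodule S.toSubmodule
  obtain ⟨ι, _, F, hF1, hF⟩ := exists_sum_rank_one_idempotents k S
  obtain ⟨j, hj⟩ : ∃ j, e * (F j : A) ≠ 0 := by
    by_contra! hn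
    apply he.ne_zero
    have h1 : (∑ j, (F j : A)) = 1 := by
      rw [← AddSubmonoidClass.coe_finsetSum, hF1]; rfl
    rw [← mul_one e, ← h1, Finset.mul_sum]
    exact Finset.sum_eq_zero fun j _ => hn j
  set i : A := ((F j : S) : A) with hidef
  have hi : IsRankOneIdempotent S i :=
    { mem := (F j).2
      mul_self := congrArg Subtype.val (hF j).1
      ne_zero := fun h => hj (by rw [h, mul_zero])
      corner := fun s hs => by
        obtain ⟨c, hc⟩ := (hF j).2 ⟨s, hs⟩
        exact ⟨c, congrArg Subtype.val hc⟩ }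
  obtain ⟨x, n, hix, hxi, hx, hgen⟩ := hi.exists_nilpotent_generator p hm hS
  refine ⟨i, x, n, hi.mul_self, hix, hxi, hx, hgen, exists_sum_of_mem_idealOfIdempotent (k := k) ?_⟩
  obtain ⟨f, hfc, hfI, hff, hfi⟩ := hS.exists_central_identity hi.mem
  have hec := Subring.mem_center_iff.mp he.mem_center
  have hff' : f * f = f := hff
  have hee' : e * e = e := he.isIdempotentElem
  have hfc' := Subring.mem_center_iff.mp hfc
  have h1f : IsIdempotentElem (1 - f) := hff.one_sub
  -- Primitivity applied to `e = ef + e(1 - f)`. The first option fails because `ei = e f i` is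
  -- nonzero; the second puts `e = ef` in `AiA`.
  have h2 : e * f = 0 ∨ e * (1 - f) = 0 := by
    refine he.primitive _ _ (mul_mem he.mem_center hfc)
      (mul_mem he.mem_center (sub_mem (one_mem _) hfc))
      (he.isIdempotentElem.mul_of_commute (hfc' e) hff)
      (he.isIdempotentElem.mul_of_commute (hec _).symm h1f) ?_ ?_
    · rw [mul_assoc, ← mul_assoc f, hec f, mul_assoc e f, mul_sub, mul_one, hff', sub_self,
        mul_zero, mul_zero]
    · rw [← mul_add, add_sub_cancel, mul_one]
  rcases h2 with h2 | h2
  · exfalso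
    apply hj
    rw [← hfi, ← mul_assoc, h2, zero_mul]
  · rw [mul_sub, mul_one, sub_eq_zero] at h2
    rw [h2]
    simpa using mul_mul_mem_idealOfIdempotent hfI e 1

end Crossed

/-! ### Reduction to blocks -/

section CentralDecomposition

variable {k A M : Type*} [Field k] [Ring A] [Algebra k A] [AddCommGroup M] [Module k M]
  [Module A M] [IsScalarTower k A M]

/-- Multiplication by a central element `e` as a linear map `M → e M`. -/
def toCentralSMul {A M : Type*} [Ring A] [AddCommGroup M] [Module A M] {e : A}
    (he : e ∈ Subring.center A) : M →ₗ[A] centralSMul e he M where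
  toFun m := ⟨e • m, m, rfl⟩
  map_add' x y := Subtype.ext (smul_add e x y)
  map_smul' r x := Subtype.ext (by
    simp only [RingHom.id_apply, SetLike.val_smul, smul_smul, Subring.mem_center_iff.mp he r])

@[simp] theorem coe_toCentralSMul {e : A} (he : e ∈ Subring.center A) (m : M) :
    (toCentralSMul he m : M) = e • m := rfl

theorem smul_coe_centralSMul {e : A} (he : e ∈ Subring.center A) (hee : IsIdempotentElem e)
    (w : centralSMul e he M) : e • (w : M) = w := by
  obtain ⟨_, m, rfl⟩ := w
  exact (smul_smul e e m).trans (by rw [hee.eq])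

theorem IsSymmetricAlg.centralSMul [FiniteDimensional k M]
    (h : IsSymmetricAlg k (Module.End A M)) {e : A} (he : e ∈ Subring.center A)
    (hee : IsIdempotentElem e) : IsSymmetricAlg k (Module.End A (centralSMul e he M)) := by
  have := finiteDimensional_moduleEnd (k := k) (R := A) M
  have : FiniteDimensional k (_root_.centralSMul e he M) :=
    inferInstanceAs (FiniteDimensional k ((_root_.centralSMul e he M).restrictScalars k))
  have := finiteDimensional_moduleEnd (k := k) (R := A) (_root_.centralSMul e he M)
  rw [isSymmetricAlg_iff] at h ⊢
  obtain ⟨l, hl⟩ := h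
  exact ⟨_, hl.retract (_root_.centralSMul e he M).subtype (toCentralSMul he) fun w =>
    Subtype.ext (smul_coe_centralSMul he hee w)⟩

theorem isSymmetricAlg_centralSMul_of_add [FiniteDimensional k M] {e f g : A}
    (he : e ∈ Subring.center A) (hf : f ∈ Subring.center A) (hg : g ∈ Subring.center A)
    (hff : IsIdempotentElem f) (hgg : IsIdempotentElem g) (hfg : f * g = 0) (hadd : f + g = e)
    (h1 : IsSymmetricAlg k (Module.End A (centralSMul f hf M)))
    (h2 : IsSymmetricAlg k (Module.End A (centralSMul g hg M))) :
    IsSymmetricAlg k (Module.End A (centralSMul e he M)) := by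
  have hfd : ∀ {e : A} (he : e ∈ Subring.center A), FiniteDimensional k (centralSMul e he M) :=
    fun he => inferInstanceAs (FiniteDimensional k ((centralSMul _ he M).restrictScalars k))
  have := hfd he
  have := hfd hf
  have := hfd hg
  have := finiteDimensional_moduleEnd (k := k) (R := A) (centralSMul e he M)
  have := finiteDimensional_moduleEnd (k := k) (R := A) (centralSMul f hf M)
  have := finiteDimensional_moduleEnd (k := k) (R := A) (centralSMul g hg M)
  have hgf : g * f = 0 := by rw [Subring.mem_center_iff.mp hf, hfg]
  have hee : IsIdempotentElem e := by
    subst hadd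
    change (f + g) * (f + g) = f + g
    rw [add_mul, mul_add, mul_add, hff.eq, hgg.eq, hfg, hgf, add_zero, zero_add]
  have hef : e * f = f := by rw [← hadd, add_mul, hff.eq, hgf, add_zero]
  have heg : e * g = g := by rw [← hadd, add_mul, hgg.eq, hfg, zero_add]
  rw [isSymmetricAlg_iff] at h1 h2 ⊢
  obtain ⟨l, hl⟩ := h1
  obtain ⟨l', hl'⟩ := h2
  have hw : ∀ w : centralSMul e he M, e • (w : M) = w := smul_coe_centralSMul he hee
  have hf' : ∀ w : centralSMul f hf M, f • (w : M) = w := smul_coe_centralSMul hf hff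
  have hg' : ∀ w : centralSMul g hg M, g • (w : M) = w := smul_coe_centralSMul hg hgg
  refine ⟨_, hl.prod hl'
    (toCentralSMul he ∘ₗ (centralSMul f hf M).subtype)
    (toCentralSMul hf ∘ₗ (centralSMul e he M).subtype) (fun w => Subtype.ext ?_)
    (toCentralSMul he ∘ₗ (centralSMul g hg M).subtype)
    (toCentralSMul hg ∘ₗ (centralSMul e he M).subtype) (fun w => Subtype.ext ?_)
    (fun w => Subtype.ext ?_) (fun φ w => Subtype.ext ?_)⟩
  · simp only [LinearMap.comp_apply, coe_toCentralSMul, Submodule.subtype_apply]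
    rw [← hf' w, smul_smul e, hef, hf', hf']
  · simp only [LinearMap.comp_apply, coe_toCentralSMul, Submodule.subtype_apply]
    rw [← hg' w, smul_smul e, heg, hg', hg']
  · simp only [LinearMap.comp_apply, coe_toCentralSMul, Submodule.subtype_apply, Submodule.coe_add]
    rw [smul_smul, smul_smul, hef, heg, ← add_smul, hadd, hw]
  -- The projection to `fM` is the action of `f`, so it commutes with every endomorphism.
  · have key : ∀ v : centralSMul e he M,
        toCentralSMul he ((centralSMul f hf M).subtype (toCentralSMul hf
          ((centralSMul e he M).subtype v))) = f • v := fun v => Subtype.ext (by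
      simp only [coe_toCentralSMul, Submodule.subtype_apply, smul_smul, hef, SetLike.val_smul])
    simp only [LinearMap.comp_apply]
    rw [key, key, map_smul]

/-- Induction on the dimension of `eA`: a nonzero central idempotent that is not a block splits as
`f + g` with `fA` and `gA` strictly smaller. -/
theorem isSymmetricAlg_centralSMul_of_blocks [FiniteDimensional k A] [FiniteDimensional k M]
    (h : ∀ (e : A) (he : IsBlockIdempotent e),
      IsSymmetricAlg k (Module.End A (centralSMul e he.mem_center M)))
    (e : A) (he : e ∈ Subring.center A) (hee : IsIdempotentElem e) :
    IsSymmetricAlg k (Module.End A (centralSMul e he M)) := by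
  induction hn : Module.finrank k (LinearMap.range (LinearMap.mulLeft k e)) using
    Nat.strong_induction_on generalizing e with
  | _ n ih =>
  subst hn
  by_cases h0 : e = 0
  · subst h0
    have : Subsingleton (Module.End A (centralSMul (0 : A) he M)) := ⟨fun φ ψ => by
      ext w
      obtain ⟨_, m, rfl⟩ := w
      have : (⟨(0 : A) • m, m, rfl⟩ : centralSMul (0 : A) he M) = 0 := Subtype.ext (zero_smul A m)
      exact congrArg Subtype.val ((congrArg φ this).trans
        ((map_zero φ).trans ((map_zero ψ).symm.trans (congrArg ψ this.symm))))⟩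
    exact isSymmetricAlg_of_subsingleton _ _
  by_cases hb : IsBlockIdempotent e
  · exact h e hb
  obtain ⟨f, g, hf, hg, hff, hgg, hfg, hadd, hf0, hg0⟩ : ∃ f g : A, f ∈ Subring.center A ∧
      g ∈ Subring.center A ∧ IsIdempotentElem f ∧ IsIdempotentElem g ∧ f * g = 0 ∧ f + g = e ∧
      f ≠ 0 ∧ g ≠ 0 := by
    by_contra! hcon
    refine hb ⟨he, hee, h0, fun f g hf hg hff hgg hfg hadd => ?_⟩
    by_cases hf0 : f = 0
    · exact .inl hf0
    · exact .inr (hcon f g hf hg hff hgg hfg hadd hf0)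
  have hlt : ∀ {f g : A}, f * g = 0 → g * f = 0 → IsIdempotentElem f → IsIdempotentElem g →
      f + g = e → g ≠ 0 → Module.finrank k (LinearMap.range (LinearMap.mulLeft k f)) <
        Module.finrank k (LinearMap.range (LinearMap.mulLeft k e)) := by
    intro f g hfg hgf hff hgg hadd hg0
    apply Submodule.finrank_lt_finrank_of_lt
    refine lt_of_le_of_ne ?_ fun heq => ?_
    · rintro _ ⟨y, rfl⟩
      refine ⟨f * y, ?_⟩
      simp only [LinearMap.mulLeft_apply, ← mul_assoc, ← hadd, add_mul, hff.eq, hgf, add_zero]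
    · have hg : g ∈ LinearMap.range (LinearMap.mulLeft k f) := by
        rw [heq]
        exact ⟨g, by simp [← hadd, add_mul, hfg, hgg.eq]⟩
      obtain ⟨y, hy⟩ := hg
      apply hg0
      rw [LinearMap.mulLeft_apply] at hy
      calc g = f * y := hy.symm
        _ = f * (f * y) := by rw [← mul_assoc, hff.eq]
        _ = 0 := by rw [hy, hfg]
  have hgf : g * f = 0 := by rw [Subring.mem_center_iff.mp hf, hfg]
  exact isSymmetricAlg_centralSMul_of_add he hf hg hff hgg hfg hadd
    (ih _ (hlt hfg hgf hff hgg hadd hg0) f hf hff rfl)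
    (ih _ (hlt hgf hfg hgg hff (by rw [add_comm, hadd]) hf0) g hg hgg rfl)

theorem isSymmetricAlg_end_iff_forall_block [FiniteDimensional k A] [FiniteDimensional k M] :
    IsSymmetricAlg k (Module.End A M) ↔ ∀ (e : A) (he : IsBlockIdempotent e),
      IsSymmetricAlg k (Module.End A (centralSMul e he.mem_center M)) := by
  refine ⟨fun h e he => h.centralSMul he.mem_center he.isIdempotentElem, fun h => ?_⟩
  have h1 := isSymmetricAlg_centralSMul_of_blocks h 1 (one_mem _) .one
  let E : M ≃ₗ[A] centralSMul (1 : A) (one_mem _) M :=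
    LinearEquiv.ofLinearMap (toCentralSMul (one_mem _)) (centralSMul (1 : A) (one_mem _) M).subtype
      (by ext w; simp) (by ext w; simp)
  exact h1.of_algEquiv (E.symm.conjAlgEquiv k)

end CentralDecomposition

/-! ### Blocks of the group algebra -/

section Blocks

open Polynomial

/-- Both properties are read off from `End W`, which is also the endomorphism ring of the nilpotent
`k[X]`-module `iW`. -/
theorem isSymmetricAlg_end_iff_of_full_corner {k A W : Type*} [Field k] [Ring A] [Algebra k A]
    [AddCommGroup W] [Module k W] [Module A W] [IsScalarTower k A W] [FiniteDimensional k W]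
    {i x : A} {n : ℕ} (hi : IsIdempotentElem i) (hix : i * x = x) (hxi : x * i = x)
    (hx : x ^ n = 0) (hgen : ∀ y, ∃ q : k[X], i * y * i = i * aeval x q)
    {ι : Type*} [Fintype ι] (a b : ι → A) (hfull : ∀ w : W, ∑ j, a j • i • b j • w = w) :
    IsSymmetricAlg k (Module.End A W) ↔ IsIsotypicModule A W := by
  let E := AlgEquiv.ofBijective _ (bijective_cornerRestrictHom (W := W) hix hxi hi hgen a b hfull)
  have hnil : ∀ w : Module.AEval' (cornerAction k W hix), (X : k[X]) ^ n • w = 0 := by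
    intro w
    obtain ⟨w, rfl⟩ := (Module.AEval'.of _).surjective w
    rw [Module.AEval'.X_pow_smul_of]
    have : (cornerAction k W hix ^ n) • w = 0 := Subtype.ext (by
      rw [Module.End.smul_def, coe_cornerAction_pow, hx, zero_smul]; rfl)
    rw [this, map_zero]
  have hE : IsSymmetricAlg k (Module.End A W) ↔
      IsSymmetricAlg k (Module.End k[X] (Module.AEval' (cornerAction k W hix))) :=
    AlgEquiv.isSymmetricAlg_iff (B := Module.End k[X] (Module.AEval' (cornerAction k W hix))) E
  rw [hE, isSymmetricAlg_end_iff_isIsotypicModule_of_nilpotent hnil,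
    isIsotypicModule_iff, isIsotypicModule_iff]
  exact ⟨.of_ringEquiv E.symm.toRingEquiv, .of_ringEquiv E.toRingEquiv⟩

/-- A Sylow `p`-subgroup maps onto a Sylow subgroup of the `p`-group `G/N`, that is, onto all of it.
-/
theorem isCyclic_quotient_of_sylow {p : ℕ} [Fact p.Prime] {G : Type*} [Group G] [Finite G]
    (hcyc : ∀ P : Sylow p G, IsCyclic P) {N : Subgroup G} [N.Normal] {n : ℕ}
    (hn : N.index = p ^ n) : IsCyclic (G ⧸ N) := by
  obtain ⟨P⟩ : Nonempty (Sylow p G) := inferInstance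
  have := hcyc P
  have hp : IsPGroup p (G ⧸ N) := IsPGroup.of_card (n := n) (by rw [← hn, N.index_eq_card])
  have hs : Function.Surjective (QuotientGroup.mk' N) := QuotientGroup.mk'_surjective N
  have htop : (⊤ : Subgroup (G ⧸ N)) = (P.mapSurjective hs : Subgroup (G ⧸ N)) :=
    (P.mapSurjective hs).is_maximal' (hp.to_subgroup ⊤) le_top
  refine isCyclic_of_surjective ((QuotientGroup.mk' N).comp (P : Subgroup G).subtype) fun q => ?_
  have hq : q ∈ (P.mapSurjective hs : Subgroup (G ⧸ N)) := htop ▸ Subgroup.mem_top q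
  obtain ⟨x, hx, rfl⟩ := hq
  exact ⟨⟨x, hx⟩, rfl⟩

theorem span_range_monoidAlgebra_of (k G : Type*) [Field k] [Group G] :
    Submodule.span k (Set.range (MonoidAlgebra.of k G)) = ⊤ := by
  rw [eq_top_iff]
  intro y _
  induction y using MonoidAlgebra.induction_on with
  | of g => exact Submodule.subset_span ⟨g, rfl⟩
  | add x y hx hy => exact Submodule.add_mem _ (hx trivial) (hy trivial)
  | smul c x hx => exact Submodule.smul_mem _ c (hx trivial)

theorem isCrossedExtension_monoidAlgebra (k : Type*) {G : Type*} [Field k] [Group G]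
    (N : Subgroup G) [N.Normal] :
    IsCrossedExtension (MonoidAlgebra.mapDomainAlgHom k k N.subtype).range N
      (MonoidAlgebra.of k G) where
  mem_of_mem n hn := ⟨MonoidAlgebra.of k N ⟨n, hn⟩, by simp⟩
  conj_mem g s hs := by
    obtain ⟨t, rfl⟩ := hs
    induction t using MonoidAlgebra.induction_on with
    | of n =>
      exact ⟨MonoidAlgebra.of k N ⟨g * n * g⁻¹, ‹N.Normal›.conj_mem n n.2 g⟩, by
        simp [MonoidAlgebra.single_mul_single]⟩
    | add x y hx hy =>
      rw [map_add, mul_add, add_mul]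
      exact add_mem hx hy
    | smul c x hx =>
      have h1 : (MonoidAlgebra.mapDomainAlgHom k k N.subtype).toRingHom (c • x) =
          c • (MonoidAlgebra.mapDomainAlgHom k k N.subtype).toRingHom x :=
        map_smul (MonoidAlgebra.mapDomainAlgHom k k N.subtype) c x
      rw [h1, mul_smul_comm, smul_mul_assoc]
      exact Subalgebra.smul_mem _ hx c
  span_eq_top := span_range_monoidAlgebra_of k G

end Blocks

theorem proposition5p7 {k : Type*} [Field k] [IsAlgClosed k]
    (p : ℕ) [Fact p.Prime] [CharP k p]
    {G : Type*} [Group G] [Finite G]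
    (hG : IsPNilpotent p G) (hcyc : ∀ P : Sylow p G, IsCyclic P)
    (M : Type*) [AddCommGroup M] [Module k M] [Module k[G] M] [IsScalarTower k k[G] M]
    [Module.Finite k[G] M] :
    IsSymmetricAlg k (Module.End k[G] M) ↔
      ∀ (e : k[G]) (he : IsBlockIdempotent e),
        IsIsotypicModule k[G] (centralSMul e he.mem_center M) := by
  obtain ⟨N, hN, hcop, n, hn⟩ := hG
  have : FiniteDimensional k k[G] :=
    ⟨⟨(Set.finite_range (MonoidAlgebra.of k G)).toFinset, by
      rw [Set.Finite.coe_toFinset, span_range_monoidAlgebra_of]⟩⟩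
  have : FiniteDimensional k M := Module.Finite.trans k[G] M
  have := isCyclic_quotient_of_sylow hcyc hn
  have : NeZero (Nat.card N : k) := ⟨fun h0 => by
    rw [CharP.cast_eq_zero_iff k p] at h0
    exact ((Fact.out : p.Prime).coprime_iff_not_dvd.mp hcop.symm) h0⟩
  -- Maschke applies to `kN` because `|N|` is invertible in `k`; semisimplicity passes to the image.
  have : IsSemisimpleRing (MonoidAlgebra.mapDomainAlgHom k k N.subtype).range :=
    RingHom.isSemisimpleRing_of_surjective
      (MonoidAlgebra.mapDomainAlgHom k k N.subtype).rangeRestrict.toRingHom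
      (MonoidAlgebra.mapDomainAlgHom k k N.subtype).rangeRestrict_surjective
  rw [isSymmetricAlg_end_iff_forall_block]
  refine forall₂_congr fun e he => ?_
  obtain ⟨i, x, r, hi, hix, hxi, hx, hgen, s, a, b, hab⟩ :=
    he.exists_full_corner p hn (isCrossedExtension_monoidAlgebra k N)
  have : FiniteDimensional k (centralSMul e he.mem_center M) :=
    inferInstanceAs (FiniteDimensional k ((centralSMul e he.mem_center M).restrictScalars k))
  -- Fullness on `eM` follows from `∑ a_j i b_j = e`, as `e` acts there as the identity.
  refine isSymmetricAlg_end_iff_of_full_corner hi hix hxi hx hgen a b fun w => Subtype.ext ?_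
  have h1 := smul_coe_centralSMul he.mem_center he.isIdempotentElem w
  replace h1 := (congrArg (· • (w : M)) hab).trans h1
  simp only [Finset.sum_smul] at h1
  rw [AddSubmonoidClass.coe_finsetSum]
  refine Eq.trans (Finset.sum_congr rfl fun j _ => ?_) h1
  simp only [mul_smul, SetLike.val_smul]
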